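/- Let $n\ge 2$, and write $x=(x_1,\dots,x_n)\in\mathbb R^{2n}$ and $y=(y_2,\dots,y_n)\in\mathbb R^{2n-2}$ with components in $\mathbb R^2$. All $L^2$ spaces are complex, $I$ is the identity, and $\hat f(p)=(2\pi)^{-d/2}\int_{\mathbb R^d} e^{-\mathrm i x\cdot p}f(x)\,dx$ is the Fourier transform on $\mathbb R^d$ (extended to $L^2$ and to Sobolev spaces). Let $\mathcal G_z=(-\tfrac12\sum_{i=1}^n\nabla_i^2-zI)^{-1}$ be the free resolvent, i.e. the Fourier multiplier $(\tfrac12|p|^2-z)^{-1}$ on $\mathbb R^{2n}$. For $1\le i<j\le n$ let $\mathcal S_{ij}:L^2(\mathbb R^{2n})\to L^2(\mathbb R^{2n-2})$ be the unbounded operator $(\mathcal S_{ij}u)(y)=u(S_{ij}y)$, where $S_{ij}y=(y_3,\dots,y_2,\dots,y_2,\dots,y_n)$ has $y_2$ in the $i$-th and $j$-th places. Precisely, with $M_{ij}q=(q_3,\dots,\tfrac12q_2+q_1,\dots,\tfrac12q_2-q_1,\dots,q_n)$ (displayed entries in the $i$-th and $j$-th places), the domain is $\{f\in L^2:\int_{\mathbb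 R^2}|\hat f(M_{ij}(q_1,\cdot))|\,dq_1\in L^2(\mathbb R^{2n-2})\}$ and $\widehat{\mathcal S_{ij}f}(q_2,\dots,q_n)=\int_{\mathbb R^2}\hat f(M_{ij}q)\,\tfrac{dq_1}{2\pi}$. Its adjoint $\mathcal S_{ij}^*:L^2(\mathbb R^{2n-2})\to\bigcap_{a>1}H^{-a}(\mathbb R^{2n})$ is given by $\widehat{\mathcal S_{ij}^*g}(p)=\tfrac1{2\pi}\hat g(p_i+p_j,p_{\overline{ij}})$, where $p_{\overline{ij}}$ is $p$ with the $i$-th and $j$-th components removed. Let $\mathcal J_z$ be the unbounded operator on $L^2(\mathbb R^{2n-2})$ with $\widehat{\mathcal J_zv}(p)=\log(\tfrac12|p|^2_{2-n}-z)\,\hat v(p)$, where $|p|_{2-n}^2=\tfrac12|p_2|^2+|p_3|^2+\dots+|p_n|^2$, and with domain $\{v\in L^2(\mathbb R^{2n-2}):\hat v\,\log(|p|^2_{2-n}+1)\in L^2(\mathbb R^{2n-2})\}$. Let $\mathrm{Dgm}(n,m)$ be the set of sequences $((i_1,j_1),\dots,(i_m,j_m))$ of pairs with $1\le i_s<j_s\le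 n$ and $(i_s,j_s)\ne(i_{s+1},j_{s+1})$ for $1\le s<m$. **Proposition 1.3.** There is a universal constant $C\in(0,\infty)$ such that for all $n\ge2$, all $\beta_\star\in\mathbb R$ and all $z\in\mathbb C$ with $\operatorname{Re}z<-e^{Cn^2+\beta_\star}$ the following hold. (a) The operator $\mathcal J_z-\beta_\star I$ has a bounded inverse on $L^2(\mathbb R^{2n-2})$, and $$\mathcal R_z=\mathcal G_z+\sum_{m=1}^\infty\ \sum_{((i_s,j_s))_{s}\in\mathrm{Dgm}(n,m)}\mathcal G_z\mathcal S^*_{i_1j_1}\,\big(4\pi(\mathcal J_z-\beta_\star I)^{-1}\big)\prod_{s=2}^m\Big(\mathcal S_{i_{s-1}j_{s-1}}\mathcal G_z\mathcal S^*_{i_sj_s}\,\big(4\pi(\mathcal J_z-\beta_\star I)^{-1}\big)\Big)\,\mathcal S_{i_mj_m}\mathcal G_z$$ defines a bounded operator on $L^2(\mathbb R^{2n})$: every term is an everywhere defined bounded operator, and the sum converges absolutely in operator norm. (b) The operator $\frac1{4\pi}(\mathcal J_z-\beta_\star I)-\frac2{n(n-1)}\sum_{(i<j)\ne(k<\ell)}\mathcal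 S_{ij}\mathcal G_z\mathcal S^*_{k\ell}$ (sum over all ordered couples of distinct pairs) has a bounded inverse on $L^2(\mathbb R^{2n-2})$, the formula $$\mathcal R_z^{\mathrm{sym}}=\mathcal G_z+\frac2{n(n-1)}\Big(\sum_{i<j}\mathcal G_z\mathcal S^*_{ij}\Big)\Big(\frac1{4\pi}(\mathcal J_z-\beta_\star I)-\frac2{n(n-1)}\sum_{(i<j)\ne(k<\ell)}\mathcal S_{ij}\mathcal G_z\mathcal S^*_{k\ell}\Big)^{-1}\Big(\sum_{i<j}\mathcal S_{ij}\mathcal G_z\Big)$$ defines a bounded operator on $L^2(\mathbb R^{2n})$, and $\mathcal R_zu=\mathcal R^{\mathrm{sym}}_zu$ for every $u\in L^2(\mathbb R^{2n})$ that is symmetric in its $n$ components. -/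

import Mathlib

open MeasureTheory
open scoped FourierTransform ENNReal

noncomputable section

namespace DeltaBose

/-! ## Configuration spaces and Fourier transform

Throughout, the number of particles is `n = N + 2`, so that `n ≥ 2` is built in. -/

/-- `(ℝ²)ⁿ = ℝ²ⁿ` with its Euclidean structure and Lebesgue measure: `x = (x₁, …, xₙ)` with
components `x i ∈ ℝ²`. -/
abbrev Config (n : ℕ) := PiLp 2 (fun _ : Fin n => EuclideanSpace ℝ (Fin 2))

/-- The complex Hilbert space `L²(ℝ²ⁿ)`. -/
abbrev L2 (n : ℕ) := Lp (α := Config n) ℂ 2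

/-- Generalized functions on `ℝ²ⁿ` whose Fourier transform is a measurable function; such an
object is represented by its Fourier transform (modulo null sets). All Sobolev spaces
`H^a(ℝ²ⁿ)`, `a ∈ ℝ`, consist of such objects. -/
abbrev FreqFun (n : ℕ) := Config n →ₘ[(volume : Measure (Config n))] ℂ

/-- `L²(ℝ²ⁿ)` as a space of generalized functions: `u` is represented by its Fourier transform.
The convention is Mathlib's, `û(ξ) = ∫ e^{-2πi x·ξ} u(x) dx`; the momentum is `p = 2πξ`. -/
def hat {n : ℕ} : L2 n →ₗ[ℂ] FreqFun n where
  toFun u := ((𝓕 u : L2 n) : FreqFun n)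
  map_add' u v := by rw [FourierTransform.fourier_add]; rfl
  map_smul' c u := by rw [FourierTransform.fourier_smul]; rfl

/-- The partially defined inverse of `hat`: its domain consists of the generalized functions that
are in `L²(ℝ²ⁿ)`. -/
def ofHat {n : ℕ} : FreqFun n →ₗ.[ℂ] L2 n where
  domain := Lp.LpSubmodule ℂ ℂ 2 volume
  toFun :=
    { toFun := fun h => 𝓕⁻ (⟨h.1, h.2⟩ : L2 n)
      map_add' := fun a b => by
        rw [← FourierTransform.fourierInv_add]; rfl
      map_smul' := fun c a => by
        simp only [RingHom.id_apply]
        rw [← FourierTransform.fourierInv_smul]; rfl }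

/-- The Fourier multiplier with symbol `m` on generalized functions. -/
def mulFreq {n : ℕ} (m : FreqFun n) : FreqFun n →ₗ[ℂ] FreqFun n where
  toFun h := m * h
  map_add' a b := by
    induction m using AEEqFun.induction_on
    induction a using AEEqFun.induction_on
    induction b using AEEqFun.induction_on
    simp only [AEEqFun.mk_add_mk, AEEqFun.mk_mul_mk, mul_add]
  map_smul' c a := by
    induction m using AEEqFun.induction_on
    induction a using AEEqFun.induction_on
    simp only [AEEqFun.smul_mk, AEEqFun.mk_mul_mk, mul_smul_comm, RingHom.id_apply]

/-! ## Unbounded operators -/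

/-- Composition of partially defined operators on the natural domain
`{x ∈ Dom f : f x ∈ Dom g}`. -/
def pcomp {E F G : Type*} [AddCommGroup E] [Module ℂ E] [AddCommGroup F] [Module ℂ F]
    [AddCommGroup G] [Module ℂ G] (g : F →ₗ.[ℂ] G) (f : E →ₗ.[ℂ] F) : E →ₗ.[ℂ] G where
  domain := (g.domain.comap f.toFun).map f.domain.subtype
  toFun :=
    { toFun := fun x => g ⟨f ⟨x.1, by
          obtain ⟨y, _, hy⟩ := x.2; rw [← hy]; exact y.2⟩, by
          obtain ⟨_, ⟨y, hy', rfl⟩⟩ := x; exact hy'⟩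
      map_add' := fun x y => by
        refine Eq.trans ?_ (g.map_add _ _)
        congr 1; ext1; refine Eq.trans ?_ (f.map_add _ _); rfl
      map_smul' := fun c x => by
        refine Eq.trans ?_ (g.map_smul _ _)
        congr 1; ext1; refine Eq.trans ?_ (f.map_smul _ _); rfl }


/-- `A` is everywhere defined and is the bounded operator `T`. -/
def IsBdd {E F : Type*} [NormedAddCommGroup E] [NormedSpace ℂ E] [NormedAddCommGroup F]
    [NormedSpace ℂ F] (A : E →ₗ.[ℂ] F) (T : E →L[ℂ] F) : Prop :=
  A = (T : E →ₗ[ℂ] F).toPMap ⊤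

/-- `A` is injective, and its inverse is everywhere defined and bounded. -/
def HasBddInverse {E F : Type*} [NormedAddCommGroup E] [NormedSpace ℂ E] [NormedAddCommGroup F]
    [NormedSpace ℂ F] (A : E →ₗ.[ℂ] F) : Prop :=
  LinearMap.ker A.toFun = ⊥ ∧ ∃ B : F →L[ℂ] E, IsBdd A.inverse B

/-- The operator on `L²` of Fourier multiplication by `m`, with its maximal domain
`{u : m û ∈ L²}`. -/
def fourierMul {n : ℕ} (m : FreqFun n) : L2 n →ₗ.[ℂ] L2 n :=
  pcomp ofHat ((mulFreq m ∘ₗ hat).toPMap ⊤)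

/-! ## The free resolvent -/

/-- The symbol `(½|p|² - z)⁻¹`, `p = 2πξ`. -/
def greenSymbol (n : ℕ) (z : ℂ) : FreqFun n :=
  AEEqFun.mk (fun ξ => (((1 / 2 * ‖(2 * Real.pi) • ξ‖ ^ 2 : ℝ) : ℂ) - z)⁻¹)
    (Measurable.aestronglyMeasurable (by fun_prop))

/-- `𝒢_z = (-½ ∑ᵢ ∇ᵢ² - z)⁻¹` on `L²(ℝ²ⁿ)`. -/
def green (n : ℕ) (z : ℂ) : L2 n →ₗ.[ℂ] L2 n := fourierMul (greenSymbol n z)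

/-! ## The operators `𝒮ᵢⱼ` and `𝒮ᵢⱼ*` -/

/-- The pairs `i < j` of indices in `{1, …, n}`, `n = N + 2`. -/
abbrev Pair (N : ℕ) := {p : Fin (N + 2) × Fin (N + 2) // p.1 < p.2}

namespace Pair

variable {N : ℕ}

/-- The smaller index `i` of the pair. -/
abbrev fst (p : Pair N) : Fin (N + 2) := p.1.1

/-- The larger index `j` of the pair. -/
abbrev snd (p : Pair N) : Fin (N + 2) := p.1.2

/-- The position of `i` among the indices different from `j`. It is the same as that of `i`
in `{1, …, n}`, as `i < j`. -/
def fst' (p : Pair N) : Fin (N + 1) := p.1.1.castLT (by have := p.2; omega)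

/-- The increasing enumeration of the indices different from `i` and `j`. -/
def rest (p : Pair N) (k : Fin N) : Fin (N + 2) := p.snd.succAbove (p.fst'.succAbove k)

/-- Put `a` in the `i`-th place, `b` in the `j`-th place and `c` (in order) in the other places. -/
def place {α : Type*} (p : Pair N) (a b : α) (c : Fin N → α) : Fin (N + 2) → α :=
  p.snd.insertNth b (p.fst'.insertNth a c)

theorem succAbove_fst' (p : Pair N) : p.snd.succAbove p.fst' = p.fst := by
  have := p.2
  rw [Fin.succAbove_of_castSucc_lt]
  · rfl
  · exact this

@[simp] theorem place_fst {α : Type*} (p : Pair N) (a b : α) (c : Fin N → α) :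
    p.place a b c p.fst = a := by
  rw [← succAbove_fst', place, Fin.insertNth_apply_succAbove, Fin.insertNth_apply_same]

@[simp] theorem place_snd {α : Type*} (p : Pair N) (a b : α) (c : Fin N → α) :
    p.place a b c p.snd = b := by
  rw [place, Fin.insertNth_apply_same]

@[simp] theorem place_rest {α : Type*} (p : Pair N) (a b : α) (c : Fin N → α) (k : Fin N) :
    p.place a b c (p.rest k) = c k := by
  rw [place, rest, Fin.insertNth_apply_succAbove, Fin.insertNth_apply_succAbove]

theorem index_cases {P : Fin (N + 2) → Prop} (p : Pair N) (h1 : P p.fst) (h2 : P p.snd)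
    (h3 : ∀ k, P (p.rest k)) (l : Fin (N + 2)) : P l := by
  rcases Fin.eq_self_or_eq_succAbove p.snd l with rfl | ⟨l, rfl⟩
  · exact h2
  · rcases Fin.eq_self_or_eq_succAbove p.fst' l with rfl | ⟨k, rfl⟩
    · rw [succAbove_fst']; exact h1
    · exact h3 k

end Pair

variable {N : ℕ}

/-- The linear map `Mᵢⱼ (q₁, (q₂, …, qₙ)) = (q₃, …, ½q₂ + q₁, …, ½q₂ - q₁, …, qₙ)`, the two
displayed entries being the `i`-th and the `j`-th one. -/
def splitMap (p : Pair N) : EuclideanSpace ℝ (Fin 2) × Config (N + 1) →ₗ[ℝ] Config (N + 2) where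
  toFun q := WithLp.toLp 2 (p.place ((1 / 2 : ℝ) • q.2 0 + q.1) ((1 / 2 : ℝ) • q.2 0 - q.1)
    (fun k => q.2 k.succ))
  map_add' q r := by
    ext1 l
    refine p.index_cases (P := fun l => _ = _) ?_ ?_ ?_ l
    · simp; abel
    · simp; abel
    · intro k; simp
  map_smul' c q := by
    ext1 l
    refine p.index_cases (P := fun l => _ = _) ?_ ?_ ?_ l
    · simp [smul_smul, mul_comm]
    · simp [smul_smul, mul_comm, smul_sub]
    · intro k; simp

/-- The linear map `p ↦ (pᵢ + pⱼ, p with its i-th and j-th components removed)`. -/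
def mergeMap (p : Pair N) : Config (N + 2) →ₗ[ℝ] Config (N + 1) where
  toFun x := WithLp.toLp 2
    (Fin.cons (x p.fst + x p.snd) (fun k => x (p.rest k)) :
      Fin (N + 1) → EuclideanSpace ℝ (Fin 2))
  map_add' x y := by
    ext1 l
    refine Fin.cases ?_ (fun k => ?_) l
    · simp; abel
    · simp
  map_smul' c x := by
    ext1 l
    refine Fin.cases ?_ (fun k => ?_) l
    · simp
    · simp

theorem splitMap_surjective (p : Pair N) : Function.Surjective (splitMap p) := by
  intro x
  refine ⟨((1 / 2 : ℝ) • (x p.fst - x p.snd), mergeMap p x), ?_⟩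
  ext1 l
  refine p.index_cases (P := fun l => _ = _) ?_ ?_ ?_ l
  · simp [splitMap, mergeMap]; module
  · simp [splitMap, mergeMap]; module
  · intro k; simp [splitMap, mergeMap]

theorem mergeMap_surjective (p : Pair N) : Function.Surjective (mergeMap p) := by
  intro y
  refine ⟨splitMap p (0, y), ?_⟩
  ext1 l
  refine Fin.cases ?_ (fun k => ?_) l
  · simp [splitMap, mergeMap]; module
  · simp [splitMap, mergeMap]

theorem quasiMeasurePreserving_of_surjective {E F : Type*} [NormedAddCommGroup E]
    [NormedSpace ℝ E] [FiniteDimensional ℝ E] [MeasurableSpace E] [BorelSpace E]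
    [NormedAddCommGroup F] [NormedSpace ℝ F] [MeasurableSpace F] [BorelSpace F]
    (μ : Measure E) (ν : Measure F) [μ.IsAddHaarMeasure] [ν.IsAddHaarMeasure]
    (L : E →ₗ[ℝ] F) (hL : Function.Surjective L) : Measure.QuasiMeasurePreserving L μ ν := by
  have : FiniteDimensional ℝ F := Module.Finite.of_surjective L hL
  refine ⟨L.continuous_of_finiteDimensional.measurable, ?_⟩
  obtain ⟨c, -, hc⟩ := L.exists_map_addHaar_eq_smul_addHaar μ ν hL
  rw [hc]
  exact Measure.smul_absolutelyContinuous

theorem splitMap_qmp (p : Pair N) : Measure.QuasiMeasurePreserving (splitMap p)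
    ((volume : Measure (EuclideanSpace ℝ (Fin 2))).prod (volume : Measure (Config (N + 1))))
    volume :=
  have : ((volume : Measure (EuclideanSpace ℝ (Fin 2))).prod
      (volume : Measure (Config (N + 1)))).IsAddHaarMeasure :=
    Measure.prod.instIsAddHaarMeasure _ _
  quasiMeasurePreserving_of_surjective _ _ _ (splitMap_surjective p)

theorem mergeMap_qmp (p : Pair N) : Measure.QuasiMeasurePreserving (mergeMap p)
    (volume : Measure (Config (N + 2))) (volume : Measure (Config (N + 1))) :=
  quasiMeasurePreserving_of_surjective _ _ _ (mergeMap_surjective p)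

/-- The adjoint `𝒮ᵢⱼ*`. It maps `v ∈ L²(ℝ²ⁿ⁻²)` to the generalized function on `ℝ²ⁿ` with Fourier
transform `v̂(pᵢ + pⱼ, p_rest)`. No factor `2π` appears in the present normalization of the Fourier
transform. -/
def raise (p : Pair N) : L2 (N + 1) →ₗ[ℂ] FreqFun (N + 2) where
  toFun v := (hat v).compQuasiMeasurePreserving (mergeMap p) (mergeMap_qmp p)
  map_add' u v := by
    rw [map_add]
    generalize hat u = a
    generalize hat v = b
    induction a using AEEqFun.induction_on
    induction b using AEEqFun.induction_on
    rfl
  map_smul' c u := by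
    rw [map_smul]
    generalize hat u = a
    induction a using AEEqFun.induction_on
    rfl

theorem splitMap_ae (p : Pair N) {P : Config (N + 2) → Prop} (h : ∀ᵐ x, P x) :
    ∀ᵐ q' : Config (N + 1), ∀ᵐ q₁ : EuclideanSpace ℝ (Fin 2), P (splitMap p (q₁, q')) := by
  have h1 := (splitMap_qmp p).ae h
  have h2 := (Measure.prod_swap (μ := (volume : Measure (Config (N + 1))))
    (ν := (volume : Measure (EuclideanSpace ℝ (Fin 2)))))
  rw [← h2] at h1
  exact Measure.ae_ae_of_ae_prod (ae_of_ae_map measurable_swap.aemeasurable h1)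

theorem measurable_fiber (p : Pair N) (h : FreqFun (N + 2)) :
    Measurable fun q : EuclideanSpace ℝ (Fin 2) × Config (N + 1) => h (splitMap p q) :=
  h.stronglyMeasurable.measurable.comp (splitMap_qmp p).measurable

theorem measurable_slice (p : Pair N) (h : FreqFun (N + 2)) (q' : Config (N + 1)) :
    Measurable fun q₁ : EuclideanSpace ℝ (Fin 2) => h (splitMap p (q₁, q')) :=
  (measurable_fiber p h).comp measurable_prodMk_right

/-- The fibre integral `∫ |f̂(Mᵢⱼ(q₁, q'))| dq₁` for `q' ∈ ℝ²ⁿ⁻²`. -/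
def fiberNorm (p : Pair N) (f : L2 (N + 2)) (q' : Config (N + 1)) : ℝ≥0∞ :=
  ∫⁻ q₁ : EuclideanSpace ℝ (Fin 2), ‖hat f (splitMap p (q₁, q'))‖ₑ

/-- The fibre integral `∫ f̂(Mᵢⱼ(q₁, q')) dq₁` for `q' ∈ ℝ²ⁿ⁻²`. -/
def fiberInt (p : Pair N) (f : L2 (N + 2)) (q' : Config (N + 1)) : ℂ :=
  ∫ q₁ : EuclideanSpace ℝ (Fin 2), hat f (splitMap p (q₁, q'))

theorem measurable_fiberNorm (p : Pair N) (f : L2 (N + 2)) : Measurable (fiberNorm p f) :=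
  (measurable_fiber p (hat f)).enorm.lintegral_prod_left'

theorem hat_add_ae (p : Pair N) (f g : L2 (N + 2)) :
    ∀ᵐ q' : Config (N + 1), ∀ᵐ q₁ : EuclideanSpace ℝ (Fin 2),
      hat (f + g) (splitMap p (q₁, q')) =
        hat f (splitMap p (q₁, q')) + hat g (splitMap p (q₁, q')) := by
  rw [map_add]
  exact splitMap_ae p (AEEqFun.coeFn_add (hat f) (hat g))

theorem hat_smul_ae (p : Pair N) (c : ℂ) (f : L2 (N + 2)) :
    ∀ᵐ q' : Config (N + 1), ∀ᵐ q₁ : EuclideanSpace ℝ (Fin 2),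
      hat (c • f) (splitMap p (q₁, q')) = c * hat f (splitMap p (q₁, q')) := by
  rw [map_smul]
  exact splitMap_ae p (AEEqFun.coeFn_smul c (hat f))

/-- The domain `{f : ∫ |f̂(Mᵢⱼ(q₁, ·))| dq₁ ∈ L²(ℝ²ⁿ⁻²)}` of `𝒮ᵢⱼ`. -/
def lowerDomain (p : Pair N) : Submodule ℂ (L2 (N + 2)) where
  carrier := {f | ∫⁻ q', fiberNorm p f q' ^ 2 < ∞}
  zero_mem' := by
    have h : ∀ᵐ q', fiberNorm p 0 q' = 0 := by
      filter_upwards [hat_smul_ae p 0 0] with q' hq'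
      rw [fiberNorm, lintegral_eq_zero_iff'
        (measurable_slice p _ q').enorm.aemeasurable]
      filter_upwards [hq'] with q₁ hq
      simp
    have h' : ∫⁻ q', fiberNorm p 0 q' ^ 2 = 0 := by
      rw [lintegral_eq_zero_iff ((measurable_fiberNorm p 0).pow_const 2)]
      filter_upwards [h] with q' hq'
      simp [hq']
    simp [h']
  add_mem' := by
    intro f g hf hg
    have h : ∀ᵐ q', fiberNorm p (f + g) q' ≤ fiberNorm p f q' + fiberNorm p g q' := by
      filter_upwards [hat_add_ae p f g] with q' hq'
      rw [fiberNorm, fiberNorm, fiberNorm, ← lintegral_add_left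
        (measurable_slice p _ q').enorm]
      refine lintegral_mono_ae ?_
      filter_upwards [hq'] with q₁ hq
      rw [hq]
      exact enorm_add_le _ _
    have h2 : ∀ a b : ℝ≥0∞, (a + b) ^ 2 ≤ 2 * a ^ 2 + 2 * b ^ 2 := by
      intro a b
      have := ENNReal.rpow_add_le_mul_rpow_add_rpow a b (p := 2) (by norm_num)
      norm_num at this
      rwa [mul_add] at this
    calc ∫⁻ q', fiberNorm p (f + g) q' ^ 2
        ≤ ∫⁻ q', (2 * fiberNorm p f q' ^ 2 + 2 * fiberNorm p g q' ^ 2) := by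
          refine lintegral_mono_ae ?_
          filter_upwards [h] with q' hq'
          exact (pow_le_pow_left' hq' 2).trans (h2 _ _)
      _ = 2 * (∫⁻ q', fiberNorm p f q' ^ 2) + 2 * (∫⁻ q', fiberNorm p g q' ^ 2) := by
          rw [lintegral_add_left (((measurable_fiberNorm p f).pow_const 2).const_mul 2),
            lintegral_const_mul _ ((measurable_fiberNorm p f).pow_const 2),
            lintegral_const_mul _ ((measurable_fiberNorm p g).pow_const 2)]
      _ < ∞ := ENNReal.add_lt_top.2
          ⟨ENNReal.mul_lt_top ENNReal.ofNat_lt_top hf, ENNReal.mul_lt_top ENNReal.ofNat_lt_top hg⟩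
  smul_mem' := by
    intro c f hf
    have h : ∀ᵐ q', fiberNorm p (c • f) q' = ‖c‖ₑ * fiberNorm p f q' := by
      filter_upwards [hat_smul_ae p c f] with q' hq'
      rw [fiberNorm, fiberNorm, ← lintegral_const_mul _
        (measurable_slice p _ q').enorm]
      refine lintegral_congr_ae ?_
      filter_upwards [hq'] with q₁ hq
      rw [hq]
      exact enorm_mul _ _
    have h' : ∫⁻ q', fiberNorm p (c • f) q' ^ 2 = ‖c‖ₑ ^ 2 * ∫⁻ q', fiberNorm p f q' ^ 2 := by
      rw [← lintegral_const_mul _ ((measurable_fiberNorm p f).pow_const 2)]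
      refine lintegral_congr_ae ?_
      filter_upwards [h] with q' hq'
      rw [hq', mul_pow]
    change ∫⁻ q', fiberNorm p (c • f) q' ^ 2 < ∞
    rw [h']
    exact ENNReal.mul_lt_top (by simp [enorm_lt_top]) hf

theorem memLp_fiberInt (p : Pair N) {f : L2 (N + 2)} (hf : f ∈ lowerDomain p) :
    MemLp (fiberInt p f) 2 volume := by
  refine ⟨?_, ?_⟩
  · exact ((measurable_fiber p (hat f)).stronglyMeasurable.integral_prod_left'
      (μ := (volume : Measure (EuclideanSpace ℝ (Fin 2))))).aestronglyMeasurable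
  · rw [eLpNorm_lt_top_iff_lintegral_rpow_enorm_lt_top (by norm_num) (by norm_num)]
    refine lt_of_le_of_lt (lintegral_mono fun q' => ?_) hf
    have : ((2 : ℝ≥0∞).toReal) = ((2 : ℕ) : ℝ) := by norm_num
    rw [this, ENNReal.rpow_natCast]
    exact pow_le_pow_left' (enorm_integral_le_lintegral_enorm _) 2

theorem integrable_fiber (p : Pair N) {f : L2 (N + 2)} (hf : f ∈ lowerDomain p) :
    ∀ᵐ q' : Config (N + 1), Integrable fun q₁ : EuclideanSpace ℝ (Fin 2) =>
      hat f (splitMap p (q₁, q')) := by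
  filter_upwards [ae_lt_top ((measurable_fiberNorm p f).pow_const 2) hf.ne] with q' hq'
  refine ⟨(measurable_slice p _ q').aestronglyMeasurable, ?_⟩
  exact (ENNReal.pow_lt_top_iff.1 hq').resolve_right (by norm_num)

theorem fiberInt_add (p : Pair N) {f g : L2 (N + 2)} (hf : f ∈ lowerDomain p)
    (hg : g ∈ lowerDomain p) : fiberInt p (f + g) =ᵐ[volume] fiberInt p f + fiberInt p g := by
  filter_upwards [hat_add_ae p f g, integrable_fiber p hf, integrable_fiber p hg] with q' h1 h2 h3
  rw [Pi.add_apply, fiberInt, fiberInt, fiberInt, ← integral_add h2 h3]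
  exact integral_congr_ae h1

theorem fiberInt_smul (p : Pair N) (c : ℂ) (f : L2 (N + 2)) :
    fiberInt p (c • f) =ᵐ[volume] c • fiberInt p f := by
  filter_upwards [hat_smul_ae p c f] with q' h1
  rw [Pi.smul_apply, fiberInt, fiberInt, smul_eq_mul, ← integral_const_mul]
  exact integral_congr_ae h1

/-- The Fourier transform of `𝒮ᵢⱼ f`, an element of `L²(ℝ²ⁿ⁻²)`. -/
def lowerHat (p : Pair N) : lowerDomain p →ₗ[ℂ] L2 (N + 1) where
  toFun f := (memLp_fiberInt p f.2).toLp (fiberInt p f.1)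
  map_add' f g :=
    (MemLp.toLp_congr _ ((memLp_fiberInt p f.2).add (memLp_fiberInt p g.2))
      (fiberInt_add p f.2 g.2)).trans (MemLp.toLp_add _ _)
  map_smul' c f :=
    (MemLp.toLp_congr _ ((memLp_fiberInt p f.2).const_smul c) (fiberInt_smul p c f.1)).trans
      (MemLp.toLp_const_smul c _)

/-- The lowering operator `𝒮ᵢⱼ : L²(ℝ²ⁿ) → L²(ℝ²ⁿ⁻²)`, an unbounded operator. On Schwartz functions
`u` it is the restriction `(𝒮ᵢⱼ u)(y) = u(Sᵢⱼ y)`, where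
`Sᵢⱼ (y₂, …, yₙ) = (y₃, …, y₂, …, y₂, …, yₙ)` repeats `y₂` in the `i`-th and the `j`-th place; in
general, the Fourier transform of `𝒮ᵢⱼ f` is `q' ↦ ∫ f̂(Mᵢⱼ(q₁, q')) dq₁`. -/
def lower (p : Pair N) : L2 (N + 2) →ₗ.[ℂ] L2 (N + 1) where
  domain := lowerDomain p
  toFun := (Lp.fourierTransformₗᵢ (Config (N + 1)) ℂ).symm.toLinearEquiv.toLinearMap ∘ₗ lowerHat p

/-! ## Incoming, outgoing and mediating operators -/

/-- The incoming operator `𝒮ᵢⱼ 𝒢_z`. -/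
def incoming (z : ℂ) (p : Pair N) : L2 (N + 2) →ₗ.[ℂ] L2 (N + 1) :=
  pcomp (lower p) (green (N + 2) z)

/-- The outgoing operator `𝒢_z 𝒮ᵢⱼ*`. Here `𝒢_z` acts on generalized functions, and the domain
consists of all `v ∈ L²(ℝ²ⁿ⁻²)` for which the result is in `L²(ℝ²ⁿ)`. -/
def outgoing (z : ℂ) (p : Pair N) : L2 (N + 1) →ₗ.[ℂ] L2 (N + 2) :=
  pcomp ofHat ((mulFreq (greenSymbol (N + 2) z) ∘ₗ raise p).toPMap ⊤)

/-- The mediating operator `𝒮ᵢⱼ 𝒢_z 𝒮ₖₗ*`, where `p = (i, j)` and `q = (k, l)`. -/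
def mediating (z : ℂ) (p q : Pair N) : L2 (N + 1) →ₗ.[ℂ] L2 (N + 1) :=
  pcomp (lower p) (outgoing z q)

/-- The quadratic form `½|p₂|² + |p₃|² + … + |pₙ|²` of `(p₂, …, pₙ)`. -/
def reducedSq (y : Config (N + 1)) : ℝ := 1 / 2 * ‖y 0‖ ^ 2 + ∑ k : Fin N, ‖y k.succ‖ ^ 2

theorem measurable_reducedSq : Measurable (reducedSq (N := N)) := by
  unfold reducedSq
  have (i : Fin (N + 1)) : Measurable fun y : Config (N + 1) => y i :=
    (PiLp.continuous_apply 2 _ i).measurable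
  exact (((this 0).norm.pow_const 2).const_mul _).add
    (Finset.measurable_sum _ fun k _ => (this k.succ).norm.pow_const 2)

/-- The symbol `log(½(½|p₂|² + |p₃|² + … + |pₙ|²) - z)`, `p = 2πξ`. -/
def jSymbol (N : ℕ) (z : ℂ) : FreqFun (N + 1) :=
  AEEqFun.mk (fun ξ => Complex.log (((1 / 2 * reducedSq ((2 * Real.pi) • ξ) : ℝ) : ℂ) - z))
    (Measurable.aestronglyMeasurable (by
      have := (measurable_reducedSq (N := N)).comp (measurable_const_smul (2 * Real.pi))
      exact ((Complex.measurable_ofReal.comp (this.const_mul _)).sub_const z).clog))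

/-- The weight `log(½|p₂|² + |p₃|² + … + |pₙ|² + 1)`, `p = 2πξ`. -/
def jWeight (N : ℕ) : FreqFun (N + 1) :=
  AEEqFun.mk (fun ξ => ((Real.log (reducedSq ((2 * Real.pi) • ξ) + 1) : ℝ) : ℂ))
    (Measurable.aestronglyMeasurable (by
      have := (measurable_reducedSq (N := N)).comp (measurable_const_smul (2 * Real.pi))
      exact Complex.measurable_ofReal.comp (this.add_const 1).log))

/-- The unbounded operator `𝒥_z` on `L²(ℝ²ⁿ⁻²)`: the Fourier multiplier with symbol
`log(½(½|p₂|² + |p₃|² + … + |pₙ|²) - z)`, and with domain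
`{v ∈ L² : v̂(p) log(½|p₂|² + |p₃|² + … + |pₙ|² + 1) ∈ L²}`. -/
def jOp (N : ℕ) (z : ℂ) : L2 (N + 1) →ₗ.[ℂ] L2 (N + 1) :=
  (fourierMul (jSymbol N z)).domRestrict (fourierMul (jWeight N)).domain

/-- The operator `𝒥_z - β I`. -/
def jSub (N : ℕ) (β : ℝ) (z : ℂ) : L2 (N + 1) →ₗ.[ℂ] L2 (N + 1) :=
  jOp N z - ((β : ℂ) • LinearMap.id).toPMap ⊤

/-- The operator `4π (𝒥_z - β I)⁻¹`. -/
def jInv (N : ℕ) (β : ℝ) (z : ℂ) : L2 (N + 1) →ₗ.[ℂ] L2 (N + 1) :=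
  ((4 * Real.pi : ℝ) : ℂ) • (jSub N β z).inverse

/-! ## The resolvent series -/

/-- The diagrams: the disjoint union over `m ≥ 1` of the sets of sequences of `m` pairs `i < j` in
which consecutive pairs are different. In `⟨k, d⟩`, the number of pairs is `m = k + 1`. -/
abbrev Dgm (N : ℕ) :=
  Σ k : ℕ, {d : Fin (k + 1) → Pair N // ∀ s : Fin k, d s.castSucc ≠ d s.succ}

/-- The product
`4π(𝒥_z - β)⁻¹ ∏_{s = 2}^m (𝒮_{i_{s-1} j_{s-1}} 𝒢_z 𝒮*_{i_s j_s} 4π(𝒥_z - β)⁻¹)`,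
ordered from left to right. -/
def chain (β : ℝ) (z : ℂ) : (k : ℕ) → (Fin (k + 1) → Pair N) → L2 (N + 1) →ₗ.[ℂ] L2 (N + 1)
  | 0, _ => jInv N β z
  | k + 1, d => pcomp (jInv N β z) (pcomp (mediating z (d 0) (d 1)) (chain β z k (Fin.tail d)))

/-- The term of the series that belongs to a diagram:
`𝒢_z 𝒮*_{i₁ j₁} 4π(𝒥_z - β)⁻¹ ∏_{s = 2}^m (…) 𝒮_{i_m j_m} 𝒢_z`. -/
def term (β : ℝ) (z : ℂ) (d : Dgm N) : L2 (N + 2) →ₗ.[ℂ] L2 (N + 2) :=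
  pcomp (outgoing z (d.2.1 0))
    (pcomp (chain β z d.1 d.2.1) (incoming z (d.2.1 (Fin.last d.1))))

/-! ## The symmetric resolvent -/

/-- `u ∈ L²(ℝ²ⁿ)` is symmetric in its `n` components. -/
def IsSymm {n : ℕ} (u : L2 n) : Prop :=
  ∀ σ : Equiv.Perm (Fin n), (fun x : Config n => u (WithLp.toLp 2 fun i => x (σ i))) =ᵐ[volume] u

/-- The coefficient `2 / (n(n-1))`. -/
def pairCoeff (N : ℕ) : ℂ := 2 / (((N : ℂ) + 2) * ((N : ℂ) + 1))

/-- The operator `(4π)⁻¹ (𝒥_z - β I) - 2/(n(n-1)) ∑ 𝒮ᵢⱼ 𝒢_z 𝒮ₖₗ*`, summed over all ordered couples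
of different pairs `(i < j) ≠ (k < l)`. -/
def symOp (N : ℕ) (β : ℝ) (z : ℂ) : L2 (N + 1) →ₗ.[ℂ] L2 (N + 1) :=
  ((1 / (4 * Real.pi) : ℝ) : ℂ) • jSub N β z - pairCoeff N •
    ∑ c : Pair N × Pair N with c.1 ≠ c.2, mediating z c.1 c.2

/-- The operator
`𝒢_z + 2/(n(n-1)) (∑ 𝒢_z 𝒮ᵢⱼ*) ((4π)⁻¹ (𝒥_z - β I) - 2/(n(n-1)) ∑ 𝒮ᵢⱼ 𝒢_z 𝒮ₖₗ*)⁻¹ (∑ 𝒮ᵢⱼ 𝒢_z)`. -/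
def symResolvent (N : ℕ) (β : ℝ) (z : ℂ) : L2 (N + 2) →ₗ.[ℂ] L2 (N + 2) :=
  green (N + 2) z + pairCoeff N •
    pcomp (∑ p : Pair N, outgoing z p) (pcomp (symOp N β z).inverse (∑ p : Pair N, incoming z p))

end DeltaBose
end

open DeltaBose

noncomputable section

namespace DeltaBose

/-! ### Partially defined operators -/

section Abstract

variable {E F G : Type*} [NormedAddCommGroup E] [NormedSpace ℂ E] [NormedAddCommGroup F]
  [NormedSpace ℂ F] [NormedAddCommGroup G] [NormedSpace ℂ G]

/-! After Fourier transform every operator is explicit: 𝒢_z is multiplication by (½|p|² - z)⁻¹, 𝒮ᵢⱼ*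
extends a function constantly along the fibres of `mergeMap`, 𝒮ᵢⱼ integrates along these fibres, and
(𝒥_z - β)⁻¹ is multiplication by a reciprocal logarithm. By Plancherel, boundedness becomes a matter
of estimating integrals over two-dimensional fibres.

Write J for 4π(𝒥_z - β)⁻¹, and I_p, O_p, M_{pq} for the incoming, outgoing and mediating operators.
Convergence rests on two norm bounds. With c = 100n² and Re z < -e^{c+β}, the real part of the
symbol of 𝒥_z - β is at least c, so ‖J‖ ≤ 4π/c (`exists_jSub_inverse`). For p ≠ q, ‖M_{pq}‖ ≤ 1/2
uniformly in n and z, by a Schur test with a kernel of Hilbert type in one component from q∖p and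
one from p∖q (`exists_isBdd_mediating`). At most (n²/2)^m diagrams have length m, so the series is
dominated by a geometric one with ratio at most π/100 (`card_mul_lt_one`). I_p and O_p need no such
care: the squared resolvent symbol has uniformly bounded fibre integrals.

For the closed form, let u be symmetric. Then all I_p u are the same vector φ, and φ is symmetric in
all components but the first. On vectors w with this symmetry, the sum of M_{pq} w over q ≠ p does
not depend on p, hence equals B w with B the mean over p (`meanOp`), and both B and J preserve the
symmetry (`exists_common_incoming`). The diagrams of length k + 1 therefore add up to (∑ O_p)(JB)^k
Jφ (`sum_boundedTerm`). Summing over k produces the Neumann series of (J⁻¹ - B)⁻¹, and the factor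
2/(n(n-1)), the reciprocal of the number of pairs, compensates for ∑ I_p u containing φ once per
pair. -/

theorem mem_pcomp_domain {E F G : Type*} [AddCommGroup E] [Module ℂ E] [AddCommGroup F]
    [Module ℂ F] [AddCommGroup G] [Module ℂ G] {g : F →ₗ.[ℂ] G} {f : E →ₗ.[ℂ] F} {x : E} :
    x ∈ (pcomp g f).domain ↔ ∃ hx : x ∈ f.domain, f ⟨x, hx⟩ ∈ g.domain := by
  constructor
  · rintro ⟨y, hy, rfl⟩
    exact ⟨y.2, hy⟩
  · rintro ⟨hx, h⟩
    exact ⟨⟨x, hx⟩, h, rfl⟩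

theorem pcomp_apply {E F G : Type*} [AddCommGroup E] [Module ℂ E] [AddCommGroup F]
    [Module ℂ F] [AddCommGroup G] [Module ℂ G] {g : F →ₗ.[ℂ] G} {f : E →ₗ.[ℂ] F} {x : E}
    (h : x ∈ (pcomp g f).domain) (hx : x ∈ f.domain) (hg : f ⟨x, hx⟩ ∈ g.domain) :
    pcomp g f ⟨x, h⟩ = g ⟨f ⟨x, hx⟩, hg⟩ := rfl

theorem isBdd_of_apply {A : E →ₗ.[ℂ] F} {T : E →L[ℂ] F}
    (h : ∀ x, ∃ hx : x ∈ A.domain, A ⟨x, hx⟩ = T x) : IsBdd A T := by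
  refine LinearPMap.ext (eq_top_iff.2 fun x _ => (h x).1) ?_
  intro x h1 h2
  exact (h x).2

theorem IsBdd.mem {A : E →ₗ.[ℂ] F} {T : E →L[ℂ] F} (h : IsBdd A T) (x : E) : x ∈ A.domain := by
  rw [h]; trivial

theorem IsBdd.apply {A : E →ₗ.[ℂ] F} {T : E →L[ℂ] F} (h : IsBdd A T) (x : E)
    (hx : x ∈ A.domain) : A ⟨x, hx⟩ = T x := by
  subst h; rfl

theorem IsBdd.pcomp {g : F →ₗ.[ℂ] G} {f : E →ₗ.[ℂ] F} {S : F →L[ℂ] G} {T : E →L[ℂ] F}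
    (hg : IsBdd g S) (hf : IsBdd f T) : IsBdd (pcomp g f) (S ∘L T) := by
  refine isBdd_of_apply fun x => ⟨mem_pcomp_domain.2 ⟨hf.mem x, hg.mem _⟩, ?_⟩
  rw [pcomp_apply _ (hf.mem x) (hg.mem _), hg.apply, hf.apply]
  rfl

theorem IsBdd.add {f g : E →ₗ.[ℂ] F} {S T : E →L[ℂ] F} (hf : IsBdd f S) (hg : IsBdd g T) :
    IsBdd (f + g) (S + T) := by
  refine isBdd_of_apply fun x => ⟨⟨hf.mem x, hg.mem x⟩, ?_⟩
  rw [LinearPMap.add_apply]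
  exact congrArg₂ (· + ·) (hf.apply x _) (hg.apply x _)

theorem IsBdd.smul {f : E →ₗ.[ℂ] F} {S : E →L[ℂ] F} (c : ℂ) (hf : IsBdd f S) :
    IsBdd (c • f) (c • S) := by
  refine isBdd_of_apply fun x => ⟨hf.mem x, ?_⟩
  rw [LinearPMap.smul_apply]
  exact congrArg (c • ·) (hf.apply x _)

theorem isBdd_zero : IsBdd (0 : E →ₗ.[ℂ] F) 0 :=
  isBdd_of_apply fun _ => ⟨trivial, rfl⟩

theorem IsBdd.sum {ι : Type*} (s : Finset ι) {f : ι → E →ₗ.[ℂ] F} {S : ι → E →L[ℂ] F}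
    (h : ∀ i ∈ s, IsBdd (f i) (S i)) : IsBdd (∑ i ∈ s, f i) (∑ i ∈ s, S i) := by
  classical
  induction s using Finset.induction_on with
  | empty => simpa using isBdd_zero
  | insert a s ha ih =>
    rw [Finset.sum_insert ha, Finset.sum_insert ha]
    exact (h a (by simp)).add (ih fun i hi => h i (by simp [hi]))

/-- A two-sided inverse of a partially defined operator. -/
theorem isBdd_inverse {A : E →ₗ.[ℂ] F} {T : F →L[ℂ] E}
    (h1 : ∀ y, ∃ hy : T y ∈ A.domain, A ⟨T y, hy⟩ = y) (h2 : ∀ x : A.domain, T (A x) = x) :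
    LinearMap.ker A.toFun = ⊥ ∧ IsBdd A.inverse T := by
  have hker : LinearMap.ker A.toFun = ⊥ := by
    refine LinearMap.ker_eq_bot'.2 fun x hx => ?_
    have := h2 x
    rw [show A x = 0 from hx, map_zero] at this
    exact Subtype.ext this.symm
  refine ⟨hker, isBdd_of_apply fun y => ?_⟩
  obtain ⟨hy, hAy⟩ := h1 y
  have hmem : y ∈ A.inverse.domain := by
    rw [LinearPMap.inverse_domain]
    exact ⟨⟨T y, hy⟩, hAy⟩
  exact ⟨hmem, LinearPMap.inverse_apply_eq (y := ⟨y, hmem⟩) hker hAy⟩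

/-- If `A` has the bounded inverse `T` and `T B` is small, then `c A - B` is invertible, where
`c S = T`. -/
theorem isBdd_inverse_sub {A : E →ₗ.[ℂ] E} {B : E →ₗ.[ℂ] E} {T S K : E →L[ℂ] E}
    (h1 : ∀ y, ∃ hy : T y ∈ A.domain, A ⟨T y, hy⟩ = y) (h2 : ∀ x : A.domain, T (A x) = x)
    (hB : IsBdd B S) (hK1 : ∀ x, K (x - T (S x)) = x) (hK2 : ∀ x, K x - T (S (K x)) = x) :
    LinearMap.ker (A - B).toFun = ⊥ ∧ IsBdd (A - B).inverse (K ∘L T) := by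
  apply isBdd_inverse
  · intro y
    -- This fixed-point identity writes `K (T y)` as a value of `T`, which is what puts it in the
    -- domain of `A`.
    have hK : K (T y) = T (y + S (K (T y))) := by
      rw [map_add]
      exact sub_eq_iff_eq_add.1 (hK2 (T y))
    obtain ⟨h3, h4⟩ := h1 (y + S (K (T y)))
    have h5 : (K ∘L T) y ∈ A.domain := by
      change K (T y) ∈ _
      rw [hK]; exact h3
    refine ⟨⟨h5, hB.mem _⟩, ?_⟩
    rw [LinearPMap.sub_apply]
    have e1 : A ⟨(K ∘L T) y, h5⟩ = y + S (K (T y)) := by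
      rw [← h4]
      congr 1
      exact Subtype.ext hK
    have e2 := hB.apply ((K ∘L T) y) (hB.mem _)
    refine (congrArg₂ (· - ·) e1 e2).trans ?_
    simp
  · intro x
    rw [LinearPMap.sub_apply]
    have e2 := hB.apply x.1 (hB.mem _)
    have e1 := h2 ⟨x.1, x.2.1⟩
    have : T (A ⟨x.1, x.2.1⟩ - B ⟨x.1, x.2.2⟩) = x - T (S x) := by
      rw [map_sub, e1, e2]
    change K (T (A ⟨x.1, x.2.1⟩ - B ⟨x.1, x.2.2⟩)) = x
    rw [this, hK1]

end Abstract

/-! ### Fourier multipliers -/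

variable {n : ℕ}

theorem eLpNorm_two_sq {α : Type*} [MeasurableSpace α] {μ : Measure α} (f : α → ℂ) :
    eLpNorm f 2 μ ^ 2 = ∫⁻ x, ‖f x‖ₑ ^ 2 ∂μ := by
  have := eLpNorm_nnreal_pow_eq_lintegral (μ := μ) (f := f) (p := 2) (by norm_num)
  simpa using this

theorem enorm_sq_eq_lintegral (u : L2 n) : ‖u‖ₑ ^ 2 = ∫⁻ x, ‖u x‖ₑ ^ 2 := by
  rw [Lp.enorm_def, eLpNorm_two_sq]

theorem coe_hat (u : L2 n) : hat u = ((𝓕 u : L2 n) : FreqFun n) := rfl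

theorem lintegral_hat (u : L2 n) : ∫⁻ x, ‖hat u x‖ₑ ^ 2 = ‖u‖ₑ ^ 2 := by
  rw [coe_hat, ← enorm_sq_eq_lintegral, ← ofReal_norm, ← ofReal_norm, Lp.norm_fourier_eq]

theorem hat_injective : Function.Injective (hat (n := n)) := by
  intro u v h
  have : (𝓕 u : L2 n) = 𝓕 v := Subtype.ext h
  exact (Lp.fourierTransformₗᵢ (Config n) ℂ).injective this

theorem hat_fourierInv (u : L2 n) : hat (𝓕⁻ u : L2 n) = u := by
  rw [coe_hat, FourierTransform.fourier_fourierInv_eq]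

theorem hat_sub (u v : L2 n) : hat (u - v) = hat u - hat v := map_sub _ _ _

theorem mem_Lp_iff_lintegral {h : FreqFun n} :
    h ∈ Lp ℂ 2 (volume : Measure (Config n)) ↔ ∫⁻ x, ‖h x‖ₑ ^ 2 < ∞ := by
  rw [Lp.mem_Lp_iff_eLpNorm_lt_top, ← eLpNorm_two_sq]
  simp

section OfHat

variable {E : Type*} [NormedAddCommGroup E] [NormedSpace ℂ E]

theorem mem_ofHat_comp_domain {L : E →ₗ[ℂ] FreqFun n} {x : E} :
    x ∈ (pcomp ofHat (L.toPMap ⊤)).domain ↔ L x ∈ Lp ℂ 2 (volume : Measure (Config n)) := by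
  rw [mem_pcomp_domain]
  exact ⟨fun ⟨_, h⟩ => h, fun h => ⟨trivial, h⟩⟩

theorem hat_ofHat_comp {L : E →ₗ[ℂ] FreqFun n} (x : (pcomp ofHat (L.toPMap ⊤)).domain) :
    hat (pcomp ofHat (L.toPMap ⊤) x) = L x := by
  have h := mem_ofHat_comp_domain.1 x.2
  exact hat_fourierInv (⟨L x, h⟩ : L2 n)

theorem enorm_le_of_sq_le {a b : ℝ≥0∞} (h : a ^ 2 ≤ b ^ 2) : a ≤ b :=
  (ENNReal.pow_le_pow_left_iff (by norm_num)).1 h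

theorem norm_le_of_enorm_sq_le {E F : Type*} [NormedAddCommGroup E] [NormedAddCommGroup F] {K : ℝ}
    (hK : 0 ≤ K) {x : E} {y : F} (h : ‖y‖ₑ ^ 2 ≤ ENNReal.ofReal (K ^ 2) * ‖x‖ₑ ^ 2) : ‖y‖ ≤ K * ‖x‖ := by
  rw [ENNReal.ofReal_pow hK, ← mul_pow] at h
  have := enorm_le_of_sq_le h
  rwa [← ofReal_norm, ← ofReal_norm, ← ENNReal.ofReal_mul hK,
    ENNReal.ofReal_le_ofReal_iff (by positivity)] at this

/-- An everywhere defined operator with a bound is a bounded operator. -/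
theorem exists_isBdd {F : Type*} [NormedAddCommGroup F] [NormedSpace ℂ F] {A : E →ₗ.[ℂ] F} {K : ℝ}
    (hK : 0 ≤ K) (hd : ∀ x, x ∈ A.domain)
    (h : ∀ x (hx : x ∈ A.domain), ‖A ⟨x, hx⟩‖ₑ ^ 2 ≤ ENNReal.ofReal (K ^ 2) * ‖x‖ₑ ^ 2) :
    ∃ T : E →L[ℂ] F, IsBdd A T ∧ ‖T‖ ≤ K := by
  let L : E →ₗ[ℂ] F :=
    { toFun := fun x => A ⟨x, hd x⟩
      map_add' := fun x y => A.map_add ⟨x, hd x⟩ ⟨y, hd y⟩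
      map_smul' := fun c x => A.map_smul c ⟨x, hd x⟩ }
  exact ⟨L.mkContinuous K fun x => norm_le_of_enorm_sq_le hK (h x (hd x)),
    isBdd_of_apply fun x => ⟨hd x, rfl⟩, L.mkContinuous_norm_le hK _⟩

/-- By Plancherel an `L²` bound on the Fourier side gives both membership in the domain and the
operator norm. The formula for `hat (T x)` is kept because all later comparisons are made on Fourier
transforms. -/
theorem exists_isBdd_ofHat_comp {L : E →ₗ[ℂ] FreqFun n} {K : ℝ} (hK : 0 ≤ K)
    (h : ∀ x, ∫⁻ ξ, ‖L x ξ‖ₑ ^ 2 ≤ ENNReal.ofReal (K ^ 2) * ‖x‖ₑ ^ 2) :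
    ∃ T : E →L[ℂ] L2 n, IsBdd (pcomp ofHat (L.toPMap ⊤)) T ∧ ‖T‖ ≤ K ∧ ∀ x, hat (T x) = L x := by
  have hd : ∀ x, x ∈ (pcomp ofHat (L.toPMap ⊤)).domain := fun x =>
    mem_ofHat_comp_domain.2 (mem_Lp_iff_lintegral.2 ((h x).trans_lt
      (ENNReal.mul_lt_top ENNReal.ofReal_lt_top (by simp [enorm_lt_top]))))
  obtain ⟨T, hT, hn⟩ := exists_isBdd hK hd (fun x hx => by
    rw [← lintegral_hat, hat_ofHat_comp]
    exact h x)
  refine ⟨T, hT, hn, fun x => ?_⟩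
  rw [← hT.apply x (hd x), hat_ofHat_comp]

end OfHat

theorem mulFreq_ae (m h : FreqFun n) : ∀ᵐ ξ, mulFreq m h ξ = m ξ * h ξ :=
  AEEqFun.coeFn_mul m h

theorem lintegral_mulFreq_le {m : FreqFun n} {K : ℝ} (hm : ∀ᵐ ξ, ‖m ξ‖ ≤ K) (u : L2 n) :
    ∫⁻ ξ, ‖mulFreq m (hat u) ξ‖ₑ ^ 2 ≤ ENNReal.ofReal (K ^ 2) * ‖u‖ₑ ^ 2 := by
  rw [← lintegral_hat, ← lintegral_const_mul' _ _ ENNReal.ofReal_ne_top]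
  refine lintegral_mono_ae ?_
  filter_upwards [hm, mulFreq_ae m (hat u)] with ξ h1 h2
  rw [h2, enorm_mul, mul_pow, ENNReal.ofReal_pow ((norm_nonneg _).trans h1), ← ofReal_norm]
  gcongr

theorem exists_isBdd_fourierMul {m : FreqFun n} {K : ℝ} (hK : 0 ≤ K) (hm : ∀ᵐ ξ, ‖m ξ‖ ≤ K) :
    ∃ T : L2 n →L[ℂ] L2 n, IsBdd (fourierMul m) T ∧ ‖T‖ ≤ K ∧
      ∀ u, hat (T u) = mulFreq m (hat u) :=
  exists_isBdd_ofHat_comp hK (fun u => lintegral_mulFreq_le hm u)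

theorem mem_fourierMul_domain {m : FreqFun n} {u : L2 n} :
    u ∈ (fourierMul m).domain ↔ mulFreq m (hat u) ∈ Lp ℂ 2 (volume : Measure (Config n)) :=
  mem_ofHat_comp_domain

theorem hat_fourierMul {m : FreqFun n} (u : (fourierMul m).domain) :
    hat (fourierMul m u) = mulFreq m (hat (u : L2 n)) := hat_ofHat_comp u

/-! ### The operator `𝒥_z` -/

variable {N : ℕ}

theorem reducedSq_nonneg (y : Config (N + 1)) : 0 ≤ reducedSq y := by
  unfold reducedSq
  positivity

/-- `½(½|p₂|² + |p₃|² + … + |pₙ|²)`, `p = 2πξ`. -/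
def jEnergy (ξ : Config (N + 1)) : ℝ := 1 / 2 * reducedSq ((2 * Real.pi) • ξ)

theorem jEnergy_nonneg (ξ : Config (N + 1)) : 0 ≤ jEnergy ξ :=
  mul_nonneg (by norm_num) (reducedSq_nonneg _)

theorem measurable_jEnergy : Measurable (jEnergy (N := N)) :=
  ((measurable_reducedSq (N := N)).comp (measurable_const_smul (2 * Real.pi))).const_mul _

/-- The symbol of `(𝒥_z - β)⁻¹`. -/
def jInvSymbol (N : ℕ) (β : ℝ) (z : ℂ) : FreqFun (N + 1) :=
  AEEqFun.mk (fun ξ =>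
    (Complex.log ((jEnergy ξ : ℂ) - z) - (β : ℂ))⁻¹)
    ((((Complex.measurable_ofReal.comp measurable_jEnergy).sub_const z).clog.sub_const
      _).inv.aestronglyMeasurable)

theorem jInvSymbol_ae (β : ℝ) (z : ℂ) : ∀ᵐ ξ, jInvSymbol N β z ξ =
    (Complex.log ((jEnergy ξ : ℂ) - z) - (β : ℂ))⁻¹ :=
  AEEqFun.coeFn_mk _ _

theorem jSymbol_ae (z : ℂ) : ∀ᵐ ξ, jSymbol N z ξ =
    Complex.log ((jEnergy ξ : ℂ) - z) :=
  AEEqFun.coeFn_mk _ _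

theorem jWeight_ae : ∀ᵐ ξ, jWeight N ξ =
    ((Real.log (2 * jEnergy ξ + 1) : ℝ) : ℂ) := by
  have h0 : ∀ᵐ ξ, jWeight N ξ = ((Real.log (reducedSq ((2 * Real.pi) • ξ) + 1) : ℝ) : ℂ) :=
    AEEqFun.coeFn_mk _ _
  filter_upwards [h0] with ξ h
  refine h.trans ?_
  rw [jEnergy, ← mul_assoc]
  norm_num

/-! ### Lower bounds for the logarithmic symbol -/

section LogBounds

variable {c β : ℝ} {z : ℂ}

theorem le_log_sub (hz : z.re < -Real.exp (c + β)) {a : ℝ} (ha : 0 ≤ a) :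
    c ≤ Real.log (a - z.re) - β := by
  have h1 : Real.exp (c + β) ≤ a - z.re := by linarith
  have := (Real.le_log_iff_exp_le ((Real.exp_pos _).trans_le h1)).2 h1
  linarith

/-- The real part of log w is log|w| ≥ log(Re w), so complex z costs nothing compared with its real
part. -/
theorem log_sub_le_norm (hz : z.re < -Real.exp (c + β)) {a : ℝ} (ha : 0 ≤ a) :
    Real.log (a - z.re) - β ≤ ‖Complex.log ((a : ℂ) - z) - (β : ℂ)‖ := by
  have h0 := Real.exp_pos (c + β)
  refine le_trans ?_ (Complex.re_le_norm _)
  rw [Complex.sub_re, Complex.log_re, Complex.ofReal_re]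
  gcongr
  · linarith
  · calc a - z.re = ((a : ℂ) - z).re := by simp
      _ ≤ _ := Complex.re_le_norm _

/-- The domain of 𝒥_z is defined with a weight independent of z and β. This comparison shows that
the inverse symbol compensates for that weight. -/
theorem log_add_one_le (hc : 0 < c) (hz : z.re < -Real.exp (c + β)) :
    ∃ K : ℝ, 0 ≤ K ∧ ∀ a : ℝ, 0 ≤ a →
      Real.log (2 * a + 1) ≤ K * (Real.log (a - z.re) - β) := by
  have h0 := Real.exp_pos (c + β)
  -- The two entries give 2a ≤ Ma and 1 ≤ M(-Re z). The additive constants log M and β are then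
  -- absorbed because log(a - Re z) - β ≥ c > 0.
  set M : ℝ := max 2 (1 / (-z.re)) with hM
  have hM0 : 0 < M := lt_of_lt_of_le (by norm_num) (le_max_left _ _)
  refine ⟨1 + (|Real.log M| + |β|) / c, by positivity, fun a ha => ?_⟩
  have h1 : 2 * a + 1 ≤ M * (a - z.re) := by
    have h2 : 2 * a ≤ M * a := mul_le_mul_of_nonneg_right (le_max_left _ _) ha
    have h3 : 1 ≤ M * (-z.re) := by
      have : 1 / (-z.re) * (-z.re) ≤ M * (-z.re) :=
        mul_le_mul_of_nonneg_right (le_max_right _ _) (by linarith)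
      rwa [one_div_mul_cancel (by linarith)] at this
    linarith
  have h2 : Real.log (2 * a + 1) ≤ Real.log M + Real.log (a - z.re) := by
    rw [← Real.log_mul hM0.ne' (by linarith)]
    exact Real.log_le_log (by positivity) h1
  have h3 := le_log_sub hz ha
  have h4 : |Real.log M| + |β| ≤ (|Real.log M| + |β|) / c * (Real.log (a - z.re) - β) := by
    calc |Real.log M| + |β| = (|Real.log M| + |β|) / c * c := by field_simp
      _ ≤ _ := by gcongr
  linarith [le_abs_self (Real.log M), le_abs_self β]

end LogBounds

theorem mulFreq_hat_mem_Lp {h : FreqFun n} {K : ℝ} {u : L2 n}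
    (hh : ∀ᵐ ξ, ‖h ξ‖ ≤ K * ‖hat u ξ‖) : h ∈ Lp ℂ 2 (volume : Measure (Config n)) :=
  Lp.mem_Lp_of_ae_le_mul (g := (𝓕 u : L2 n)) hh

theorem mem_jSub_domain {β : ℝ} {z : ℂ} {v : L2 (N + 1)} :
    v ∈ (jSub N β z).domain ↔
      v ∈ (fourierMul (jWeight N)).domain ∧ v ∈ (fourierMul (jSymbol N z)).domain := by
  constructor
  · intro h; exact ⟨h.1.1, h.1.2⟩
  · intro h; exact ⟨h, trivial⟩

theorem hat_jSub {β : ℝ} {z : ℂ} (v : (jSub N β z).domain) :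
    hat (jSub N β z v) = mulFreq (jSymbol N z) (hat (v : L2 (N + 1))) -
      (β : ℂ) • hat (v : L2 (N + 1)) := by
  have h := (mem_jSub_domain.1 v.2).2
  rw [← hat_fourierMul ⟨v.1, h⟩, ← map_smul, ← hat_sub]
  rfl

theorem hat_jSub_ae {β : ℝ} {z : ℂ} (v : (jSub N β z).domain) : ∀ᵐ ξ,
    hat (jSub N β z v) ξ =
      (Complex.log ((jEnergy ξ : ℂ) - z) - (β : ℂ)) *
        hat (v : L2 (N + 1)) ξ := by
  rw [hat_jSub]
  filter_upwards [AEEqFun.coeFn_sub (mulFreq (jSymbol N z) (hat (v : L2 (N + 1))))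
    ((β : ℂ) • hat (v : L2 (N + 1))), mulFreq_ae (jSymbol N z) (hat (v : L2 (N + 1))),
    AEEqFun.coeFn_smul (β : ℂ) (hat (v : L2 (N + 1))), jSymbol_ae (N := N) z] with ξ h1 h2 h3 h4
  rw [h1, Pi.sub_apply, h2, h3, h4, Pi.smul_apply, smul_eq_mul, sub_mul]

/-- The symbol of `𝒥_z - β`. -/
abbrev jVal (β : ℝ) (z : ℂ) (ξ : Config (N + 1)) : ℂ :=
  Complex.log ((jEnergy ξ : ℂ) - z) - (β : ℂ)

section Inverse

variable {c β : ℝ} {z : ℂ}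

theorem le_norm_jVal (hz : z.re < -Real.exp (c + β)) (ξ : Config (N + 1)) : c ≤ ‖jVal β z ξ‖ :=
  (le_log_sub hz (jEnergy_nonneg ξ)).trans (log_sub_le_norm hz (jEnergy_nonneg ξ))

theorem jVal_ne_zero (hc : 0 < c) (hz : z.re < -Real.exp (c + β)) (ξ : Config (N + 1)) :
    jVal β z ξ ≠ 0 := norm_pos_iff.1 (hc.trans_le (le_norm_jVal hz ξ))

theorem mem_jWeight_domain (hc : 0 < c) (hz : z.re < -Real.exp (c + β)) {y v : L2 (N + 1)}
    (hv : ∀ᵐ ξ, hat v ξ = (jVal β z ξ)⁻¹ * hat y ξ) : v ∈ (fourierMul (jWeight N)).domain := by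
  obtain ⟨K, hK, hKa⟩ := log_add_one_le hc hz
  refine mem_fourierMul_domain.2 (mulFreq_hat_mem_Lp (K := K) (u := y) ?_)
  filter_upwards [mulFreq_ae (jWeight N) (hat v), hv, jWeight_ae (N := N)] with ξ h1 h2 h3
  have h0 := jEnergy_nonneg ξ
  rw [h1, h2, h3, ← mul_assoc, norm_mul]
  refine mul_le_mul_of_nonneg_right ?_ (norm_nonneg _)
  rw [norm_mul, norm_inv, ← div_eq_mul_inv, div_le_iff₀ (norm_pos_iff.2 (jVal_ne_zero hc hz ξ)),
    Complex.norm_real, Real.norm_of_nonneg (Real.log_nonneg (by linarith))]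
  exact (hKa _ h0).trans (mul_le_mul_of_nonneg_left (log_sub_le_norm hz h0) hK)

/-- The quotient of log by log - β is bounded by 1 + |β|/c, as the denominator has modulus at least
c. -/
theorem mem_jSymbol_domain (hc : 0 < c) (hz : z.re < -Real.exp (c + β)) {y v : L2 (N + 1)}
    (hv : ∀ᵐ ξ, hat v ξ = (jVal β z ξ)⁻¹ * hat y ξ) : v ∈ (fourierMul (jSymbol N z)).domain := by
  refine mem_fourierMul_domain.2 (mulFreq_hat_mem_Lp (K := 1 + |β| / c) (u := y) ?_)
  filter_upwards [mulFreq_ae (jSymbol N z) (hat v), hv, jSymbol_ae (N := N) z] with ξ h1 h2 h3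
  have h4 := jVal_ne_zero hc hz ξ
  have h7 := le_norm_jVal hz ξ
  rw [h1, h2, h3, ← mul_assoc, norm_mul]
  refine mul_le_mul_of_nonneg_right ?_ (norm_nonneg _)
  rw [norm_mul, norm_inv, ← div_eq_mul_inv, div_le_iff₀ (norm_pos_iff.2 h4)]
  have h5 : ‖Complex.log ((jEnergy ξ : ℂ) - z)‖ ≤ ‖jVal β z ξ‖ + |β| := by
    have := norm_add_le (jVal β z ξ) (β : ℂ)
    rwa [sub_add_cancel, Complex.norm_real, Real.norm_eq_abs] at this
  have h6 : |β| ≤ |β| / c * ‖jVal β z ξ‖ := by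
    calc |β| = |β| / c * c := by field_simp
      _ ≤ _ := mul_le_mul_of_nonneg_left h7 (by positivity)
  linarith

/-- The bounded inverse of `𝒥_z - β`. -/
theorem exists_jSub_inverse (hc : 0 < c) (hz : z.re < -Real.exp (c + β)) :
    ∃ J : L2 (N + 1) →L[ℂ] L2 (N + 1), ‖J‖ ≤ 1 / c ∧
      (∀ v, hat (J v) = mulFreq (jInvSymbol N β z) (hat v)) ∧
      (∀ y, ∃ hy : J y ∈ (jSub N β z).domain, jSub N β z ⟨J y, hy⟩ = y) ∧
      ∀ x : (jSub N β z).domain, J (jSub N β z x) = x := by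
  obtain ⟨J, -, hJn, hJ⟩ := exists_isBdd_fourierMul (m := jInvSymbol N β z) (K := 1 / c)
    (by positivity) (by
      filter_upwards [jInvSymbol_ae (N := N) β z] with ξ h
      rw [h, norm_inv, ← one_div]
      exact one_div_le_one_div_of_le hc (le_norm_jVal hz ξ))
  have hJae (v : L2 (N + 1)) : ∀ᵐ ξ, hat (J v) ξ = (jVal β z ξ)⁻¹ * hat v ξ := by
    rw [hJ]
    filter_upwards [mulFreq_ae (jInvSymbol N β z) (hat v), jInvSymbol_ae (N := N) β z] with ξ h1 h2
    rw [h1, h2]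
  have hdom (y : L2 (N + 1)) : J y ∈ (jSub N β z).domain :=
    mem_jSub_domain.2 ⟨mem_jWeight_domain hc hz (hJae y), mem_jSymbol_domain hc hz (hJae y)⟩
  refine ⟨J, hJn, hJ, fun y => ⟨hdom y, hat_injective (AEEqFun.ext ?_)⟩,
    fun x => hat_injective (AEEqFun.ext ?_)⟩
  · filter_upwards [hat_jSub_ae ⟨J y, hdom y⟩, hJae y] with ξ h1 h2
    rw [h1, h2, mul_inv_cancel_left₀ (jVal_ne_zero hc hz ξ)]
  · filter_upwards [hat_jSub_ae x, hJae (jSub N β z x)] with ξ h1 h2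
    rw [h2, h1, inv_mul_cancel_left₀ (jVal_ne_zero hc hz ξ)]

end Inverse

/-! ### Permutations of the components -/

/-- The isometry `x ↦ (x_{σ 1}, …, x_{σ n})`. -/
def permute (σ : Equiv.Perm (Fin n)) : Config n ≃ₗᵢ[ℝ] Config n :=
  LinearIsometryEquiv.piLpCongrLeft 2 ℝ (EuclideanSpace ℝ (Fin 2)) σ.symm

@[simp] theorem permute_apply (σ : Equiv.Perm (Fin n)) (x : Config n) (i : Fin n) :
    permute σ x i = x (σ i) := rfl

theorem permute_mp (σ : Equiv.Perm (Fin n)) :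
    MeasurePreserving (permute σ) (volume : Measure (Config n)) volume :=
  (permute σ).measurePreserving

namespace Pair

/-- The permutation that maps the `i`-th and `j`-th place to the `i₀`-th and `j₀`-th place, and acts
by `τ` on the other places. -/
def transport (p p₀ : Pair N) (τ : Equiv.Perm (Fin N)) : Equiv.Perm (Fin (N + 2)) where
  toFun := p.place p₀.fst p₀.snd (p₀.rest ∘ τ)
  invFun := p₀.place p.fst p.snd (p.rest ∘ τ.symm)
  left_inv l := by
    refine p.index_cases (P := fun l => p₀.place _ _ _ (p.place _ _ _ l) = l) ?_ ?_ ?_ l <;> simp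
  right_inv l := by
    refine p₀.index_cases (P := fun l => p.place _ _ _ (p₀.place _ _ _ l) = l) ?_ ?_ ?_ l <;> simp

@[simp] theorem transport_fst (p p₀ : Pair N) (τ : Equiv.Perm (Fin N)) :
    p.transport p₀ τ p.fst = p₀.fst := p.place_fst _ _ _

@[simp] theorem transport_snd (p p₀ : Pair N) (τ : Equiv.Perm (Fin N)) :
    p.transport p₀ τ p.snd = p₀.snd := p.place_snd _ _ _

@[simp] theorem transport_rest (p p₀ : Pair N) (τ : Equiv.Perm (Fin N)) (k : Fin N) :
    p.transport p₀ τ (p.rest k) = p₀.rest (τ k) := p.place_rest _ _ _ k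

end Pair

/-- The permutation of `{2, …, n}` that fixes `2` and acts by `τ` on the others. -/
def restPerm (τ : Equiv.Perm (Fin N)) : Equiv.Perm (Fin (N + 1)) :=
  Equiv.Perm.decomposeFin.symm (0, τ)

@[simp] theorem restPerm_zero (τ : Equiv.Perm (Fin N)) : restPerm τ 0 = 0 := by
  simp [restPerm]

@[simp] theorem restPerm_succ (τ : Equiv.Perm (Fin N)) (k : Fin N) :
    restPerm τ k.succ = (τ k).succ := by
  simp [restPerm]

@[simp] theorem splitMap_fst (p : Pair N) (q : EuclideanSpace ℝ (Fin 2) × Config (N + 1)) :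
    splitMap p q p.fst = (1 / 2 : ℝ) • q.2 0 + q.1 := p.place_fst _ _ _

@[simp] theorem splitMap_snd (p : Pair N) (q : EuclideanSpace ℝ (Fin 2) × Config (N + 1)) :
    splitMap p q p.snd = (1 / 2 : ℝ) • q.2 0 - q.1 := p.place_snd _ _ _

@[simp] theorem splitMap_rest (p : Pair N) (q : EuclideanSpace ℝ (Fin 2) × Config (N + 1))
    (k : Fin N) : splitMap p q (p.rest k) = q.2 k.succ := p.place_rest _ _ _ k

@[simp] theorem mergeMap_zero (p : Pair N) (x : Config (N + 2)) :
    mergeMap p x 0 = x p.fst + x p.snd := rfl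

@[simp] theorem mergeMap_succ (p : Pair N) (x : Config (N + 2)) (k : Fin N) :
    mergeMap p x k.succ = x (p.rest k) := rfl

theorem mergeMap_splitMap (p : Pair N) (q : EuclideanSpace ℝ (Fin 2) × Config (N + 1)) :
    mergeMap p (splitMap p q) = q.2 := by
  ext1 l
  refine Fin.cases ?_ (fun k => ?_) l
  · rw [mergeMap_zero, splitMap_fst, splitMap_snd]; module
  · rw [mergeMap_succ, splitMap_rest]

/-- This moves the fibres of one pair to those of another without touching the fibre variable. Every
comparison between pairs below goes through it. -/
theorem permute_splitMap (p p₀ : Pair N) (τ : Equiv.Perm (Fin N))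
    (q₁ : EuclideanSpace ℝ (Fin 2)) (q' : Config (N + 1)) :
    permute (p.transport p₀ τ) (splitMap p₀ (q₁, q')) =
      splitMap p (q₁, permute (restPerm τ) q') := by
  ext1 l
  refine p.index_cases (P := fun l => _ = _) ?_ ?_ ?_ l <;> simp

theorem splitMap_injective (p : Pair N) : Function.Injective (splitMap p) := by
  intro q r h
  refine Prod.ext ?_ ?_
  · have h2 : q.2 = r.2 := by rw [← mergeMap_splitMap p q, h, mergeMap_splitMap]
    have h1 : splitMap p q p.fst = splitMap p r p.fst := by rw [h]
    rw [splitMap_fst, splitMap_fst, h2] at h1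
    exact add_left_cancel h1
  · rw [← mergeMap_splitMap p q, h, mergeMap_splitMap]

/-! ### Integration over the fibres -/

theorem measurable_splitMap (p : Pair N) : Measurable (splitMap p) := (splitMap_qmp p).measurable

theorem measurable_mergeMap (p : Pair N) : Measurable (mergeMap p) := (mergeMap_qmp p).measurable

theorem lintegral_fiber_eq_prod (p : Pair N) {F : Config (N + 2) → ℝ≥0∞} (hF : Measurable F) :
    ∫⁻ q' : Config (N + 1), ∫⁻ q₁ : EuclideanSpace ℝ (Fin 2), F (splitMap p (q₁, q')) =
      ∫⁻ q, F (splitMap p q) ∂((volume : Measure (EuclideanSpace ℝ (Fin 2))).prod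
        (volume : Measure (Config (N + 1)))) :=
  (lintegral_prod_symm' _ (hF.comp (measurable_splitMap p))).symm

theorem exists_map_eq_smul_of_bijective {E F : Type*} [NormedAddCommGroup E]
    [NormedSpace ℝ E] [FiniteDimensional ℝ E] [MeasurableSpace E] [BorelSpace E]
    [NormedAddCommGroup F] [NormedSpace ℝ F] [MeasurableSpace F] [BorelSpace F]
    (μ : Measure E) (ν : Measure F) [μ.IsAddHaarMeasure] [ν.IsAddHaarMeasure]
    (L : E →ₗ[ℝ] F) (hL : Function.Bijective L) :
    ∃ c : ℝ≥0∞, c ≠ 0 ∧ c ≠ ∞ ∧ μ.map L = c • ν := by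
  have : FiniteDimensional ℝ F := Module.Finite.of_surjective L hL.2
  let e := (LinearEquiv.ofBijective L hL).toContinuousLinearEquiv
  have h : (μ.map e).IsAddHaarMeasure := inferInstance
  exact ⟨_, ENNReal.coe_ne_zero.2
    (Measure.addHaarScalarFactor_pos_of_isAddHaarMeasure (μ.map e) ν).ne', ENNReal.coe_ne_top,
    Measure.isAddLeftInvariant_eq_smul (μ.map e) ν⟩

/-- A linear bijection maps Haar measure to a multiple of Haar measure. The Jacobian is never
computed; only its being finite and nonzero matters, since the incoming bound multiplies by it and
the outgoing bound divides by it. -/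
theorem exists_lintegral_fiber (p : Pair N) : ∃ c : ℝ≥0∞, c ≠ 0 ∧ c ≠ ∞ ∧
    ∀ F : Config (N + 2) → ℝ≥0∞, Measurable F →
      ∫⁻ q' : Config (N + 1), ∫⁻ q₁ : EuclideanSpace ℝ (Fin 2), F (splitMap p (q₁, q')) =
        c * ∫⁻ x, F x := by
  have : ((volume : Measure (EuclideanSpace ℝ (Fin 2))).prod
      (volume : Measure (Config (N + 1)))).IsAddHaarMeasure :=
    Measure.prod.instIsAddHaarMeasure _ _
  obtain ⟨c, hc0, hc, hmap⟩ := exists_map_eq_smul_of_bijective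
    ((volume : Measure (EuclideanSpace ℝ (Fin 2))).prod (volume : Measure (Config (N + 1))))
    (volume : Measure (Config (N + 2))) (splitMap p)
    ⟨splitMap_injective p, splitMap_surjective p⟩
  refine ⟨c, hc0, hc, fun F hF => ?_⟩
  rw [lintegral_fiber_eq_prod p hF, ← smul_eq_mul, ← lintegral_smul_measure, ← hmap,
    lintegral_map hF (measurable_splitMap p)]

/-- A measure-preserving permutation of the components carries the fibration of `p₀` to that of `p`,
so the two Jacobians coincide. This keeps the Schur constant free of Jacobian factors. -/
theorem lintegral_fiber_eq (p p₀ : Pair N) {F : Config (N + 2) → ℝ≥0∞} (hF : Measurable F) :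
    ∫⁻ q' : Config (N + 1), ∫⁻ q₁ : EuclideanSpace ℝ (Fin 2), F (splitMap p (q₁, q')) =
      ∫⁻ q' : Config (N + 1), ∫⁻ q₁ : EuclideanSpace ℝ (Fin 2), F (splitMap p₀ (q₁, q')) := by
  obtain ⟨c, -, -, hc⟩ := exists_lintegral_fiber p₀
  have hmp := permute_mp (p.transport p₀ 1)
  have h1 := hc (F ∘ permute (p.transport p₀ 1)) (hF.comp hmp.measurable)
  have h2 (q₁ : EuclideanSpace ℝ (Fin 2)) (q' : Config (N + 1)) :
      (F ∘ permute (p.transport p₀ 1)) (splitMap p₀ (q₁, q')) = F (splitMap p (q₁, q')) := by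
    rw [Function.comp_apply, permute_splitMap]
    congr 3
    ext1 l
    refine Fin.cases ?_ (fun k => ?_) l <;> simp
  simp only [h2] at h1
  rw [h1, hc F hF]
  congr 1
  exact hmp.lintegral_comp hF

/-- Cauchy–Schwarz. -/
theorem lintegral_sq_le {α : Type*} [MeasurableSpace α] {μ : Measure α} {f a b : α → ℝ≥0∞}
    (ha : AEMeasurable a μ) (hb : AEMeasurable b μ) (h : ∀ᵐ x ∂μ, f x ^ 2 ≤ a x * b x) :
    (∫⁻ x, f x ∂μ) ^ 2 ≤ (∫⁻ x, a x ∂μ) * ∫⁻ x, b x ∂μ := by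
  have hs (t : ℝ≥0∞) : (t ^ (1 / 2 : ℝ)) ^ (2 : ℝ) = t := by
    rw [← ENNReal.rpow_mul]; norm_num
  have h1 : ∫⁻ x, f x ∂μ ≤ (∫⁻ x, a x ∂μ) ^ (1 / 2 : ℝ) * (∫⁻ x, b x ∂μ) ^ (1 / 2 : ℝ) := by
    calc ∫⁻ x, f x ∂μ
        ≤ ∫⁻ x, ((fun x => a x ^ (1 / 2 : ℝ)) * fun x => b x ^ (1 / 2 : ℝ)) x ∂μ := by
          refine lintegral_mono_ae ?_
          filter_upwards [h] with x hx
          rw [Pi.mul_apply, ← ENNReal.mul_rpow_of_nonneg _ _ (by norm_num)]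
          have := ENNReal.rpow_le_rpow hx (z := 1 / 2) (by norm_num)
          rwa [← ENNReal.rpow_natCast, ← ENNReal.rpow_mul,
            show ((2 : ℕ) : ℝ) * (1 / 2) = 1 by norm_num, ENNReal.rpow_one] at this
      _ ≤ _ := by
          have := ENNReal.lintegral_mul_le_Lp_mul_Lq μ
            (Real.holderConjugate_iff.2 ⟨by norm_num, by norm_num⟩ : Real.HolderConjugate 2 2)
            (ha.pow_const (1 / 2 : ℝ)) (hb.pow_const (1 / 2 : ℝ))
          simpa only [hs] using this
  calc (∫⁻ x, f x ∂μ) ^ 2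
      ≤ ((∫⁻ x, a x ∂μ) ^ (1 / 2 : ℝ) * (∫⁻ x, b x ∂μ) ^ (1 / 2 : ℝ)) ^ 2 :=
        pow_le_pow_left' h1 2
    _ = _ := by rw [mul_pow, ← ENNReal.rpow_two, ← ENNReal.rpow_two, hs, hs]

/-- The index `l` is one of `i` and `j`. -/
def Pair.Has (p : Pair N) (l : Fin (N + 2)) : Prop := l = p.fst ∨ l = p.snd

/-- A component `x_l` with `l ∈ {i, j}` is a coordinate on the fibres. -/
theorem lintegral_fiber_component {p : Pair N} {l : Fin (N + 2)} (hl : p.Has l)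
    (F : EuclideanSpace ℝ (Fin 2) → ℝ≥0∞) (q' : Config (N + 1)) :
    ∫⁻ q₁ : EuclideanSpace ℝ (Fin 2), F (splitMap p (q₁, q') l) = ∫⁻ b, F b := by
  rcases hl with rfl | rfl
  · simp only [splitMap_fst]
    exact lintegral_add_left_eq_self F _
  · simp only [splitMap_snd]
    exact lintegral_sub_left_eq_self F _

theorem exists_rest {p : Pair N} {k : Fin (N + 2)} (hk : ¬ p.Has k) : ∃ j, k = p.rest j := by
  revert hk
  refine p.index_cases (P := fun k => ¬ p.Has k → ∃ j, k = p.rest j) ?_ ?_ ?_ k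
  · intro h; exact absurd (Or.inl rfl) h
  · intro h; exact absurd (Or.inr rfl) h
  · intro j _; exact ⟨j, rfl⟩

/-- A pair is a two-element set listed in increasing order, so inclusion between pairs forces
equality. -/
theorem exists_has_not_has {p q : Pair N} (h : p ≠ q) : ∃ l, p.Has l ∧ ¬ q.Has l := by
  by_contra! hc
  have h1 := hc p.fst (Or.inl rfl)
  have h2 := hc p.snd (Or.inr rfl)
  have hp := p.2
  have hq := q.2
  apply h
  unfold Pair.Has at h1 h2
  simp only [Pair.fst, Pair.snd] at h1 h2
  refine Subtype.ext (Prod.ext ?_ ?_) <;> rcases h1 with h1 | h1 <;> rcases h2 with h2 | h2 <;>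
    omega

/-! ### Kernel estimates -/

/-- The symbol `(½|p|² - z)⁻¹`, `p = 2πξ`, as a function. -/
def greenVal (z : ℂ) (x : Config n) : ℂ :=
  (((1 / 2 * ‖(2 * Real.pi) • x‖ ^ 2 : ℝ) : ℂ) - z)⁻¹

theorem greenSymbol_ae (z : ℂ) : ∀ᵐ x, greenSymbol n z x = greenVal z x := AEEqFun.coeFn_mk _ _

theorem measurable_greenVal (z : ℂ) : Measurable (greenVal (n := n) z) := by
  unfold greenVal; fun_prop

theorem norm_greenVal_le {z : ℂ} {t : ℝ} {x : Config n} (ht : t ≤ ‖x‖ ^ 2)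
    (h : 0 < 2 * Real.pi ^ 2 * t - z.re) :
    ‖greenVal z x‖ ≤ 1 / (2 * Real.pi ^ 2 * t - z.re) := by
  rw [greenVal, norm_inv, ← one_div]
  refine one_div_le_one_div_of_le h (le_trans ?_ (Complex.re_le_norm _))
  rw [norm_smul, Real.norm_of_nonneg (by positivity), Complex.sub_re, Complex.ofReal_re]
  have := mul_le_mul_of_nonneg_left ht (by positivity : 0 ≤ 2 * Real.pi ^ 2)
  nlinarith

theorem norm_greenVal_le_const {z : ℂ} (hz : z.re < 0) (x : Config n) :
    ‖greenVal z x‖ ≤ 1 / (-z.re) := by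
  have := norm_greenVal_le (z := z) (t := 0) (x := x) (by positivity) (by linarith)
  simpa using this

theorem norm_component_le (x : Config n) (l : Fin n) : ‖x l‖ ^ 2 ≤ ‖x‖ ^ 2 := by
  rw [PiLp.norm_sq_eq_of_L2 (fun _ : Fin n => EuclideanSpace ℝ (Fin 2)) x]
  exact Finset.single_le_sum (f := fun i => ‖x i‖ ^ 2) (fun i _ => by positivity)
    (Finset.mem_univ l)

theorem norm_two_components_le (x : Config n) {k l : Fin n} (h : k ≠ l) :
    ‖x k‖ ^ 2 + ‖x l‖ ^ 2 ≤ ‖x‖ ^ 2 := by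
  rw [PiLp.norm_sq_eq_of_L2 (fun _ : Fin n => EuclideanSpace ℝ (Fin 2)) x,
    ← Finset.sum_pair (f := fun i => ‖x i‖ ^ 2) h]
  exact Finset.sum_le_sum_of_subset_of_nonneg (Finset.subset_univ _)
    (fun i _ _ => by positivity)

theorem measurable_component (l : Fin n) : Measurable fun x : Config n => x l :=
  (PiLp.continuous_apply 2 _ l).measurable

/-- The kernel `r / (2π² (r² + s²) s)`. -/
def hilbertKernel (r s : ℝ) : ℝ := 1 / (2 * Real.pi ^ 2 * (r ^ 2 + s ^ 2)) * (r / s)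

theorem hilbertKernel_nonneg {r s : ℝ} (hr : 0 ≤ r) (hs : 0 ≤ s) : 0 ≤ hilbertKernel r s := by
  unfold hilbertKernel; positivity

theorem measurable_hilbertKernel : Measurable fun q : ℝ × ℝ => hilbertKernel q.1 q.2 := by
  unfold hilbertKernel; fun_prop

/-- The Schur weights r/s and s/r cancel, leaving the square of an upper bound for the resolvent
symbol. Both variables must be nonzero, because division by zero would make the left side vanish. -/
theorem hilbertKernel_mul {r s : ℝ} (hr : r ≠ 0) (hs : s ≠ 0) :
    hilbertKernel r s * hilbertKernel s r = (1 / (2 * Real.pi ^ 2 * (r ^ 2 + s ^ 2))) ^ 2 := by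
  unfold hilbertKernel
  have : r ^ 2 + s ^ 2 ≠ 0 := by positivity
  rw [add_comm (s ^ 2)]
  field_simp

theorem mul_hilbertKernel {r s : ℝ} (hr : 0 < r) (hs : 0 < s) :
    s * hilbertKernel r s = 1 / (2 * Real.pi ^ 2) * r⁻¹ * (1 + (r⁻¹ * s) ^ 2)⁻¹ := by
  unfold hilbertKernel
  field_simp

/-- The kernel is homogeneous of degree -2, so its integral over the plane does not depend on r > 0.
In polar coordinates it is 2π · (2π²)⁻¹ · ∫₀^∞ (1 + t²)⁻¹ dt = 1/2. For r = 0 the kernel is zero,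
whence an inequality. -/
theorem lintegral_hilbertKernel_le {r : ℝ} (hr : 0 ≤ r) :
    ∫⁻ b : EuclideanSpace ℝ (Fin 2), ENNReal.ofReal (hilbertKernel r ‖b‖) ≤
      ENNReal.ofReal (1 / 2) := by
  rcases hr.eq_or_lt with rfl | hr
  · simp [hilbertKernel]
  have hd : Module.finrank ℝ (EuclideanSpace ℝ (Fin 2)) = 2 := by simp
  have hint : Integrable (fun b : EuclideanSpace ℝ (Fin 2) => hilbertKernel r ‖b‖) := by
    rw [integrable_fun_norm_addHaar, hd]
    refine IntegrableOn.congr_fun (f := fun s =>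
      1 / (2 * Real.pi ^ 2) * r⁻¹ * (1 + (r⁻¹ * s) ^ 2)⁻¹) ?_ (fun s hs => ?_) measurableSet_Ioi
    · exact ((integrable_inv_one_add_sq.comp_mul_left' (inv_ne_zero hr.ne')).const_mul
        _).integrableOn
    · simpa using (mul_hilbertKernel hr hs).symm
  rw [← ofReal_integral_eq_lintegral_ofReal hint
    (Filter.Eventually.of_forall fun b => hilbertKernel_nonneg hr.le (norm_nonneg b))]
  refine ENNReal.ofReal_le_ofReal (le_of_eq ?_)
  rw [integral_fun_norm_addHaar, hd]
  have h1 : ∫ s in Set.Ioi (0 : ℝ), s ^ (2 - 1) • hilbertKernel r s =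
      ∫ s in Set.Ioi (0 : ℝ), 1 / (2 * Real.pi ^ 2) * r⁻¹ * (1 + (r⁻¹ * s) ^ 2)⁻¹ :=
    setIntegral_congr_fun measurableSet_Ioi fun s hs => by
      simpa using mul_hilbertKernel hr hs
  rw [h1, integral_const_mul, integral_comp_mul_left_Ioi (fun s => (1 + s ^ 2)⁻¹) 0
    (inv_pos.2 hr), mul_zero, integral_Ioi_inv_one_add_sq, Measure.real,
    EuclideanSpace.volume_ball_fin_two]
  simp [ENNReal.toReal_ofReal Real.pi_nonneg]
  field_simp

theorem lintegral_fiber_hilbertKernel_le {p : Pair N} {k l : Fin (N + 2)} (hl : p.Has l)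
    (hk : ¬ p.Has k) (q' : Config (N + 1)) :
    ∫⁻ q₁ : EuclideanSpace ℝ (Fin 2), ENNReal.ofReal
      (hilbertKernel ‖splitMap p (q₁, q') k‖ ‖splitMap p (q₁, q') l‖) ≤ ENNReal.ofReal (1 / 2) := by
  obtain ⟨j, rfl⟩ := exists_rest hk
  simp only [splitMap_rest]
  rw [lintegral_fiber_component hl
    (fun b => ENNReal.ofReal (hilbertKernel ‖q' j.succ‖ ‖b‖))]
  exact lintegral_hilbertKernel_le (norm_nonneg _)

theorem ae_component_ne_zero (l : Fin n) : ∀ᵐ x : Config n, x l ≠ 0 := by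
  let L : Config n →ₗ[ℝ] EuclideanSpace ℝ (Fin 2) :=
    (PiLp.proj 2 (fun _ : Fin n => EuclideanSpace ℝ (Fin 2)) l : _ →L[ℝ] _)
  have hL : Function.Surjective L := fun y => ⟨PiLp.single 2 l y, by simp [L]⟩
  have := (quasiMeasurePreserving_of_surjective (volume : Measure (Config n)) volume L hL).ae
    (Measure.ae_ne volume (0 : EuclideanSpace ℝ (Fin 2)))
  exact this

/-- All components but two, and the positive term -Re z, are dropped from the denominator. This is
why the resulting operator bound depends on neither n nor z. -/
theorem enorm_greenVal_sq_le {z : ℂ} (hz : z.re < 0) {k l : Fin n} (h : k ≠ l) {x : Config n}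
    (hk : x k ≠ 0) (hl : x l ≠ 0) : ‖greenVal z x‖ₑ ^ 2 ≤
      ENNReal.ofReal (hilbertKernel ‖x k‖ ‖x l‖) * ENNReal.ofReal (hilbertKernel ‖x l‖ ‖x k‖) := by
  have hk' := norm_pos_iff.2 hk
  have hl' := norm_pos_iff.2 hl
  rw [← ENNReal.ofReal_mul (hilbertKernel_nonneg (norm_nonneg _) (norm_nonneg _)),
    hilbertKernel_mul hk'.ne' hl'.ne', ← ofReal_norm, ← ENNReal.ofReal_pow (norm_nonneg _)]
  have h1 : 0 < 2 * Real.pi ^ 2 * (‖x k‖ ^ 2 + ‖x l‖ ^ 2) := by positivity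
  refine ENNReal.ofReal_le_ofReal (pow_le_pow_left₀ (norm_nonneg _)
    ((norm_greenVal_le (norm_two_components_le x h) (by linarith)).trans ?_) 2)
  exact one_div_le_one_div_of_le h1 (by linarith)

/-- A bound for the fibre integrals of `|(½|p|² - z)⁻¹|²`. -/
def greenBound (z : ℂ) : ℝ≥0∞ :=
  ∫⁻ b : EuclideanSpace ℝ (Fin 2), ENNReal.ofReal ((1 / (2 * Real.pi ^ 2 * ‖b‖ ^ 2 - z.re)) ^ 2)

/-- The integrand decays like |b|⁻⁴ in the plane, and -Re z > 0 removes the singularity at the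
origin. -/
theorem greenBound_lt_top {z : ℂ} (hz : z.re < 0) : greenBound z < ∞ := by
  set m : ℝ := min (2 * Real.pi ^ 2) (-z.re)
  have hm : 0 < m := lt_min (by positivity) (by linarith)
  have hint : Integrable fun b : EuclideanSpace ℝ (Fin 2) =>
      (1 / m) ^ 2 * (1 + ‖b‖ ^ 2) ^ (-(4 : ℝ) / 2) :=
    (integrable_rpow_neg_one_add_norm_sq (by simp; norm_num)).const_mul _
  refine lt_of_le_of_lt (lintegral_mono fun b => ENNReal.ofReal_le_ofReal ?_)
    hint.lintegral_lt_top
  have h1 : (1 + ‖b‖ ^ 2) ^ (-(4 : ℝ) / 2) = (1 / (1 + ‖b‖ ^ 2)) ^ 2 := by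
    rw [show -(4 : ℝ) / 2 = -((2 : ℕ) : ℝ) by norm_num, Real.rpow_neg (by positivity),
      Real.rpow_natCast, one_div, inv_pow]
  have h2 : m * (1 + ‖b‖ ^ 2) ≤ 2 * Real.pi ^ 2 * ‖b‖ ^ 2 - z.re := by
    have h3 : m ≤ -z.re := min_le_right _ _
    have h4 : m * ‖b‖ ^ 2 ≤ 2 * Real.pi ^ 2 * ‖b‖ ^ 2 :=
      mul_le_mul_of_nonneg_right (min_le_left _ _) (by positivity)
    linarith
  have h5 : 0 < m * (1 + ‖b‖ ^ 2) := by positivity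
  rw [h1, ← mul_pow, one_div_mul_one_div]
  exact pow_le_pow_left₀ (one_div_nonneg.2 (h5.le.trans h2)) (one_div_le_one_div_of_le h5 h2) 2

theorem lintegral_fiber_greenVal_le {z : ℂ} (hz : z.re < 0) (p : Pair N) (q' : Config (N + 1)) :
    ∫⁻ q₁ : EuclideanSpace ℝ (Fin 2), ‖greenVal z (splitMap p (q₁, q'))‖ₑ ^ 2 ≤ greenBound z := by
  rw [greenBound, ← lintegral_fiber_component (p := p) (l := p.fst) (Or.inl rfl)
    (fun b => ENNReal.ofReal ((1 / (2 * Real.pi ^ 2 * ‖b‖ ^ 2 - z.re)) ^ 2)) q']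
  refine lintegral_mono fun q₁ => ?_
  rw [← ofReal_norm, ← ENNReal.ofReal_pow (norm_nonneg _)]
  refine ENNReal.ofReal_le_ofReal (pow_le_pow_left₀ (norm_nonneg _)
    (norm_greenVal_le (norm_component_le _ _) ?_) 2)
  have : 0 ≤ 2 * Real.pi ^ 2 * ‖splitMap p (q₁, q') p.fst‖ ^ 2 := by positivity
  linarith

/-! ### Incoming, outgoing and mediating operators are bounded -/

theorem exists_real_sq {M : ℝ≥0∞} (hM : M ≠ ∞) : ∃ K : ℝ, 0 ≤ K ∧ ENNReal.ofReal (K ^ 2) = M :=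
  ⟨√M.toReal, Real.sqrt_nonneg _, by
    rw [Real.sq_sqrt ENNReal.toReal_nonneg, ENNReal.ofReal_toReal hM]⟩

theorem measurable_hat (u : L2 n) : Measurable (hat u) := (hat u).stronglyMeasurable.measurable

theorem exists_isBdd_green {z : ℂ} (hz : z.re < 0) :
    ∃ T : L2 n →L[ℂ] L2 n, IsBdd (green n z) T ∧
      ∀ u, ∀ᵐ x, hat (T u) x = greenVal z x * hat u x := by
  obtain ⟨T, hT, -, h⟩ := exists_isBdd_fourierMul (m := greenSymbol n z) (K := 1 / (-z.re))
    (one_div_nonneg.2 (by linarith)) (by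
      filter_upwards [greenSymbol_ae (n := n) z] with x hx
      rw [hx]
      exact norm_greenVal_le_const hz x)
  refine ⟨T, hT, fun u => ?_⟩
  rw [h]
  filter_upwards [mulFreq_ae (greenSymbol n z) (hat u), greenSymbol_ae (n := n) z] with x h1 h2
  rw [h1, h2]

theorem mulFreq_green_raise_ae (z : ℂ) (p : Pair N) (v : L2 (N + 1)) :
    ∀ᵐ x, mulFreq (greenSymbol (N + 2) z) (raise p v) x = greenVal z x * hat v (mergeMap p x) := by
  have h : ∀ᵐ x, raise p v x = hat v (mergeMap p x) :=
    AEEqFun.coeFn_compQuasiMeasurePreserving (hat v) (mergeMap_qmp p)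
  filter_upwards [mulFreq_ae (greenSymbol (N + 2) z) (raise p v), greenSymbol_ae (n := N + 2) z, h]
    with x h1 h2 h3
  rw [h1, h2, h3]

/-- Integration of a function of the form `a(x) b(mergeMap p x)` over the fibres. -/
theorem lintegral_fiber_mul_le (p : Pair N) {a : Config (N + 2) → ℝ≥0∞} (ha : Measurable a)
    {D : ℝ≥0∞}
    (hD : ∀ q', ∫⁻ q₁ : EuclideanSpace ℝ (Fin 2), a (splitMap p (q₁, q')) ≤ D)
    (v : L2 (N + 1)) :
    ∫⁻ q' : Config (N + 1), ∫⁻ q₁ : EuclideanSpace ℝ (Fin 2),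
      a (splitMap p (q₁, q')) * ‖hat v (mergeMap p (splitMap p (q₁, q')))‖ₑ ^ 2 ≤
        D * ‖v‖ₑ ^ 2 := by
  rw [← lintegral_hat, ← lintegral_const_mul _ ((measurable_hat v).enorm.pow_const 2)]
  refine lintegral_mono fun q' => ?_
  simp only [mergeMap_splitMap]
  have hs : Measurable fun q₁ : EuclideanSpace ℝ (Fin 2) => splitMap p (q₁, q') :=
    (measurable_splitMap p).comp measurable_prodMk_right
  rw [lintegral_mul_const _ (f := fun q₁ => a (splitMap p (q₁, q'))) (ha.comp hs)]
  exact mul_le_mul_left (hD q') _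

/-- The factor coming from v is constant on the fibres, so the fibre integral only sees the squared
resolvent symbol, which `greenBound` controls. -/
theorem exists_isBdd_outgoing {z : ℂ} (hz : z.re < 0) (p : Pair N) :
    ∃ T : L2 (N + 1) →L[ℂ] L2 (N + 2), IsBdd (outgoing z p) T ∧
      ∀ v, ∀ᵐ x, hat (T v) x = greenVal z x * hat v (mergeMap p x) := by
  obtain ⟨c, hc0, hc, hF⟩ := exists_lintegral_fiber p
  obtain ⟨K, hK, hKM⟩ := exists_real_sq (M := c⁻¹ * greenBound z)
    (ENNReal.mul_ne_top (ENNReal.inv_ne_top.2 hc0) (greenBound_lt_top hz).ne)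
  obtain ⟨T, hT, -, h⟩ := exists_isBdd_ofHat_comp
    (L := mulFreq (greenSymbol (N + 2) z) ∘ₗ raise p) hK (fun v => by
      have hm : Measurable fun x : Config (N + 2) =>
          ‖greenVal z x‖ₑ ^ 2 * ‖hat v (mergeMap p x)‖ₑ ^ 2 :=
        ((measurable_greenVal z).enorm.pow_const 2).mul
          (((measurable_hat v).comp (measurable_mergeMap p)).enorm.pow_const 2)
      have h1 : ∫⁻ x, ‖(mulFreq (greenSymbol (N + 2) z) ∘ₗ raise p) v x‖ₑ ^ 2 =
          ∫⁻ x, ‖greenVal z x‖ₑ ^ 2 * ‖hat v (mergeMap p x)‖ₑ ^ 2 := by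
        refine lintegral_congr_ae ?_
        filter_upwards [mulFreq_green_raise_ae z p v] with x hx
        rw [← mul_pow, ← enorm_mul, ← hx]
        rfl
      rw [h1, hKM, mul_assoc, ← ENNReal.mul_le_iff_le_inv hc0 hc, ← hF _ hm]
      exact lintegral_fiber_mul_le p ((measurable_greenVal z).enorm.pow_const 2)
        (lintegral_fiber_greenVal_le hz p) v)
  refine ⟨T, hT, fun v => ?_⟩
  rw [h]
  exact mulFreq_green_raise_ae z p v

theorem hat_lower (p : Pair N) (f : (lower p).domain) :
    ∀ᵐ q', hat (lower p f) q' = fiberInt p f.1 q' := by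
  have h : hat (lower p f) = ((memLp_fiberInt p f.2).toLp (fiberInt p f.1) : L2 (N + 1)) :=
    hat_fourierInv (lowerHat p f)
  rw [h]
  exact MemLp.coeFn_toLp _

theorem enorm_lower_le (p : Pair N) (f : (lower p).domain) :
    ‖lower p f‖ₑ ^ 2 ≤ ∫⁻ q', fiberNorm p f.1 q' ^ 2 := by
  rw [← lintegral_hat]
  refine lintegral_mono_ae ?_
  filter_upwards [hat_lower p f] with q' h
  rw [h]
  exact pow_le_pow_left' (enorm_integral_le_lintegral_enorm _) 2

/-- The integral of `fiberNorm` squared decides membership in the domain of 𝒮ᵢⱼ and also dominates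
the norm of the image, so one estimate serves both. -/
theorem exists_isBdd_lower_comp {E : Type*} [NormedAddCommGroup E] [NormedSpace ℂ E] (p : Pair N)
    {A : E →ₗ.[ℂ] L2 (N + 2)} {T : E →L[ℂ] L2 (N + 2)} (hT : IsBdd A T) {K : ℝ} (hK : 0 ≤ K)
    (h : ∀ x, ∫⁻ q', fiberNorm p (T x) q' ^ 2 ≤ ENNReal.ofReal (K ^ 2) * ‖x‖ₑ ^ 2) :
    ∃ S : E →L[ℂ] L2 (N + 1), IsBdd (pcomp (lower p) A) S ∧ ‖S‖ ≤ K ∧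
      ∀ x, ∀ᵐ q', hat (S x) q' = fiberInt p (T x) q' := by
  have hd (x : E) : T x ∈ (lower p).domain := (h x).trans_lt
    (ENNReal.mul_lt_top ENNReal.ofReal_lt_top (by simp [enorm_lt_top]))
  have hAd (x : E) : x ∈ (pcomp (lower p) A).domain :=
    mem_pcomp_domain.2 ⟨hT.mem x, by rw [hT.apply]; exact hd x⟩
  have hA (x : E) (hx : x ∈ (pcomp (lower p) A).domain) :
      pcomp (lower p) A ⟨x, hx⟩ = lower p ⟨T x, hd x⟩ := by
    obtain ⟨h1, h2⟩ := mem_pcomp_domain.1 hx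
    rw [pcomp_apply hx h1 h2]
    congr 1
    exact Subtype.ext (hT.apply x _)
  obtain ⟨S, hS, hn⟩ := exists_isBdd hK hAd (fun x hx => by
    rw [hA]
    exact (enorm_lower_le p _).trans (h x))
  refine ⟨S, hS, hn, fun x => ?_⟩
  rw [← hS.apply x (hAd x), hA]
  exact hat_lower p _

/-- Cauchy–Schwarz on each fibre separates the resolvent symbol from û. The first factor is at most
`greenBound`, and the second integrates to ‖u‖² times the Jacobian. -/
theorem exists_isBdd_incoming {z : ℂ} (hz : z.re < 0) (p : Pair N) {G : L2 (N + 2) →L[ℂ] L2 (N + 2)}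
    (hG : IsBdd (green (N + 2) z) G)
    (hGh : ∀ u, ∀ᵐ x, hat (G u) x = greenVal z x * hat u x) :
    ∃ S : L2 (N + 2) →L[ℂ] L2 (N + 1), IsBdd (incoming z p) S ∧
      ∀ u, ∀ᵐ q', hat (S u) q' = fiberInt p (G u) q' := by
  obtain ⟨c, hc0, hc, hF⟩ := exists_lintegral_fiber p
  obtain ⟨K, hK, hKM⟩ := exists_real_sq (M := greenBound z * c)
    (ENNReal.mul_ne_top (greenBound_lt_top hz).ne hc)
  obtain ⟨S, hS, -, h⟩ := exists_isBdd_lower_comp p hG hK (fun u => by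
    rw [hKM, mul_assoc, ← lintegral_hat, ← hF _ ((measurable_hat u).enorm.pow_const 2),
      ← lintegral_const_mul' _ _ (greenBound_lt_top hz).ne]
    refine lintegral_mono_ae ?_
    filter_upwards [splitMap_ae p (hGh u)] with q' hq'
    refine (lintegral_sq_le (((measurable_greenVal z).comp
      ((measurable_splitMap p).comp measurable_prodMk_right)).enorm.pow_const 2).aemeasurable
      ((measurable_slice p (hat u) q').enorm.pow_const 2).aemeasurable ?_).trans
      (mul_le_mul_left (lintegral_fiber_greenVal_le hz p q') _)
    filter_upwards [hq'] with q₁ h1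
    rw [h1, enorm_mul, mul_pow]
    rfl)
  exact ⟨S, hS, h⟩

theorem measurable_hilbertKernel_component (k l : Fin n) : Measurable fun x : Config n =>
    ENNReal.ofReal (hilbertKernel ‖x k‖ ‖x l‖) :=
  (measurable_hilbertKernel.comp
    ((measurable_component k).norm.prodMk (measurable_component l).norm)).ennreal_ofReal

/-- Schur's test for the mediating operators. -/
theorem exists_isBdd_mediating {z : ℂ} (hz : z.re < 0) {p q : Pair N} (hpq : p ≠ q)
    {O : L2 (N + 1) →L[ℂ] L2 (N + 2)} (hO : IsBdd (outgoing z q) O)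
    (hOh : ∀ v, ∀ᵐ x, hat (O v) x = greenVal z x * hat v (mergeMap q x)) :
    ∃ S : L2 (N + 1) →L[ℂ] L2 (N + 1), IsBdd (mediating z p q) S ∧ ‖S‖ ≤ 1 / 2 ∧
      ∀ v, ∀ᵐ q', hat (S v) q' = fiberInt p (O v) q' := by
  -- On the fibres of `p` the component x_k is constant and x_l runs over the plane; on the fibres
  -- of `q` the roles are exchanged. So each of the two weighted kernels is integrated in the
  -- variable for which it is bounded.
  obtain ⟨l, hlp, hlq⟩ := exists_has_not_has hpq
  obtain ⟨k, hkq, hkp⟩ := exists_has_not_has hpq.symm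
  have hkl : k ≠ l := by rintro rfl; exact hlq hkq
  refine exists_isBdd_lower_comp p hO (by norm_num) (fun v => ?_)
  have hA := measurable_hilbertKernel_component k l
  have hB := measurable_hilbertKernel_component l k
  have hBV : Measurable fun x : Config (N + 2) => ENNReal.ofReal (hilbertKernel ‖x l‖ ‖x k‖) *
      ‖hat v (mergeMap q x)‖ₑ ^ 2 :=
    hB.mul (((measurable_hat v).comp (measurable_mergeMap q)).enorm.pow_const 2)
  have hae : ∀ᵐ x : Config (N + 2), ‖hat (O v) x‖ₑ ^ 2 ≤
      ENNReal.ofReal (hilbertKernel ‖x k‖ ‖x l‖) *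
        (ENNReal.ofReal (hilbertKernel ‖x l‖ ‖x k‖) * ‖hat v (mergeMap q x)‖ₑ ^ 2) := by
    filter_upwards [hOh v, ae_component_ne_zero k, ae_component_ne_zero l] with x h1 h2 h3
    rw [h1, enorm_mul, mul_pow, ← mul_assoc]
    exact mul_le_mul_left (enorm_greenVal_sq_le hz hkl h2 h3) _
  calc ∫⁻ q', fiberNorm p (O v) q' ^ 2
      ≤ ∫⁻ q' : Config (N + 1), ENNReal.ofReal (1 / 2) *
          ∫⁻ q₁ : EuclideanSpace ℝ (Fin 2),
            (fun x : Config (N + 2) => ENNReal.ofReal (hilbertKernel ‖x l‖ ‖x k‖) *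
              ‖hat v (mergeMap q x)‖ₑ ^ 2) (splitMap p (q₁, q')) := by
        refine lintegral_mono_ae ?_
        filter_upwards [splitMap_ae p hae] with q' hq'
        have hs : Measurable fun q₁ : EuclideanSpace ℝ (Fin 2) => splitMap p (q₁, q') :=
          (measurable_splitMap p).comp measurable_prodMk_right
        exact (lintegral_sq_le (hA.comp hs).aemeasurable (hBV.comp hs).aemeasurable hq').trans
          (mul_le_mul_left (lintegral_fiber_hilbertKernel_le hlp hkp q') _)
    _ = ENNReal.ofReal (1 / 2) * ∫⁻ q' : Config (N + 1), ∫⁻ q₁ : EuclideanSpace ℝ (Fin 2),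
            (fun x : Config (N + 2) => ENNReal.ofReal (hilbertKernel ‖x l‖ ‖x k‖) *
              ‖hat v (mergeMap q x)‖ₑ ^ 2) (splitMap q (q₁, q')) := by
        -- The fibration is changed from `p` to `q`: v̂ is constant on the fibres of `q`, so the
        -- remaining kernel can now be integrated by itself.
        rw [lintegral_const_mul' _ _ ENNReal.ofReal_ne_top, lintegral_fiber_eq p q hBV]
    _ ≤ ENNReal.ofReal (1 / 2) * (ENNReal.ofReal (1 / 2) * ‖v‖ₑ ^ 2) :=
        mul_le_mul_right (lintegral_fiber_mul_le q hB
          (lintegral_fiber_hilbertKernel_le hkq hlq) v) _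
    _ = _ := by
        rw [← mul_assoc, ← ENNReal.ofReal_mul (by norm_num), sq (1 / 2 : ℝ)]

/-! ### Symmetric functions -/

/-- The Fourier transform commutes with permutations of the components. -/
theorem fourier_comp_permute (σ : Equiv.Perm (Fin n)) (u : L2 n) :
    (𝓕 (Lp.compMeasurePreservingₗᵢ ℂ (permute σ) (permute_mp σ) u) : L2 n) =
      Lp.compMeasurePreservingₗᵢ ℂ (permute σ) (permute_mp σ) (𝓕 u : L2 n) := by
  let V := Lp.compMeasurePreservingₗᵢ (p := 2) (E := ℂ) ℂ (permute σ) (permute_mp σ)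
  have hV (f : SchwartzMap (Config n) ℂ) : V (f.toLp 2) =
      (SchwartzMap.compCLMOfContinuousLinearEquiv ℂ
        (permute σ).toContinuousLinearEquiv f).toLp 2 := by
    refine Lp.ext ?_
    filter_upwards [Lp.coeFn_compMeasurePreserving (f.toLp 2) (permute_mp σ),
      (permute_mp σ).quasiMeasurePreserving.ae (f.coeFn_toLp 2 volume),
      SchwartzMap.coeFn_toLp (SchwartzMap.compCLMOfContinuousLinearEquiv ℂ
        (permute σ).toContinuousLinearEquiv f) 2 volume] with x h1 h2 h3
    exact (h1.trans h2).trans h3.symm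
  -- Both sides are continuous in `u`, so Schwartz functions suffice; there the claim is the change
  -- of variables in the Fourier integral under an isometry.
  refine DenseRange.induction_on
    (p := fun u : L2 n => (𝓕 (V u) : L2 n) = V (𝓕 u : L2 n))
    (SchwartzMap.denseRange_toLpCLM (F := ℂ) (E := Config n) (p := 2) (μ := volume)
      ENNReal.ofNat_ne_top) u ?_ ?_
  · exact isClosed_eq ((Lp.fourierTransformₗᵢ (Config n) ℂ).continuous.comp V.continuous)
      (V.continuous.comp (Lp.fourierTransformₗᵢ (Config n) ℂ).continuous)
  · intro f
    rw [SchwartzMap.toLpCLM_apply, hV, SchwartzMap.toLp_fourier_eq, SchwartzMap.toLp_fourier_eq, hV]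
    congr 1
    ext x
    exact Real.fourier_comp_linearIsometry (permute σ) f x

theorem hat_permute_of_isSymm {u : L2 n} (hu : IsSymm u) (σ : Equiv.Perm (Fin n)) :
    ∀ᵐ x, hat u (permute σ x) = hat u x := by
  have h1 : Lp.compMeasurePreservingₗᵢ ℂ (permute σ) (permute_mp σ) u = u :=
    Lp.ext ((Lp.coeFn_compMeasurePreserving u (permute_mp σ)).trans (hu σ))
  have h2 := fourier_comp_permute σ u
  rw [h1] at h2
  have h3 := Lp.coeFn_compMeasurePreserving (𝓕 u : L2 n) (permute_mp σ)
  have h4 : Lp.compMeasurePreserving (permute σ) (permute_mp σ) (𝓕 u : L2 n) = 𝓕 u := h2.symm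
  rw [h4] at h3
  filter_upwards [h3] with x hx
  exact hx.symm

theorem greenVal_permute (z : ℂ) (σ : Equiv.Perm (Fin n)) (x : Config n) :
    greenVal z (permute σ x) = greenVal z x := by
  rw [greenVal, greenVal, ← (permute σ).map_smul, (permute σ).norm_map]

/-- The merged component carries the weight ½, so the permutations used here fix it. This makes
symmetry in the other components the natural class for the intermediate vectors. -/
theorem jEnergy_permute (τ : Equiv.Perm (Fin N)) (ξ : Config (N + 1)) :
    jEnergy (permute (restPerm τ) ξ) = jEnergy ξ := by
  rw [jEnergy, jEnergy, reducedSq, reducedSq, ← (permute _).map_smul]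
  simp only [permute_apply, restPerm_zero, restPerm_succ]
  rw [Equiv.sum_comp τ (fun k => ‖((2 * Real.pi) • ξ) k.succ‖ ^ 2)]

/-! ### Action of permutations on pairs -/

namespace Pair

theorem not_has_rest (p : Pair N) (k : Fin N) : ¬ p.Has (p.rest k) := by
  rintro (h | h)
  · rw [rest, ← succAbove_fst'] at h
    exact Fin.succAbove_ne _ _ (Fin.succAbove_right_injective h)
  · exact Fin.succAbove_ne _ _ h

theorem rest_injective (p : Pair N) : Function.Injective p.rest := fun _ _ h =>
  Fin.succAbove_right_injective (Fin.succAbove_right_injective h)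

theorem eq_of_has {p q : Pair N} (h : ∀ l, p.Has l → q.Has l) : p = q := by
  by_contra hpq
  obtain ⟨l, h1, h2⟩ := exists_has_not_has hpq
  exact h2 (h l h1)

/-- The image of a pair under a permutation. -/
def act (σ : Equiv.Perm (Fin (N + 2))) (q : Pair N) : Pair N :=
  if h : σ q.fst < σ q.snd then ⟨(σ q.fst, σ q.snd), h⟩ else
    ⟨(σ q.snd, σ q.fst), lt_of_le_of_ne (not_lt.1 h) fun he => q.2.ne' (σ.injective he)⟩

theorem act_has {σ : Equiv.Perm (Fin (N + 2))} {q : Pair N} {l : Fin (N + 2)} :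
    (act σ q).Has (σ l) ↔ q.Has l := by
  unfold act
  split_ifs
  · change σ l = σ q.fst ∨ σ l = σ q.snd ↔ l = q.fst ∨ l = q.snd
    rw [σ.injective.eq_iff, σ.injective.eq_iff]
  · change σ l = σ q.snd ∨ σ l = σ q.fst ↔ l = q.fst ∨ l = q.snd
    rw [σ.injective.eq_iff, σ.injective.eq_iff, or_comm]

theorem act_add {α : Type*} [AddCommMonoid α] (σ : Equiv.Perm (Fin (N + 2))) (q : Pair N)
    (x : Fin (N + 2) → α) :
    x (act σ q).fst + x (act σ q).snd = x (σ q.fst) + x (σ q.snd) := by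
  unfold act
  split_ifs
  · rfl
  · exact add_comm _ _

theorem act_injective (σ : Equiv.Perm (Fin (N + 2))) : Function.Injective (act (N := N) σ) := by
  intro p q h
  refine eq_of_has fun l hl => ?_
  rw [← act_has (σ := σ), ← h, act_has]
  exact hl

/-- The action of a permutation on pairs as a bijection. -/
def actEquiv (σ : Equiv.Perm (Fin (N + 2))) : Pair N ≃ Pair N :=
  Equiv.ofBijective (act σ) (Finite.injective_iff_bijective.1 (act_injective σ))

theorem act_transport (p p₀ : Pair N) (τ : Equiv.Perm (Fin N)) :
    act (p.transport p₀ τ) p = p₀ := by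
  refine Eq.symm (eq_of_has fun l hl => ?_)
  rcases hl with rfl | rfl
  · rw [← transport_fst p p₀ τ, act_has]; exact Or.inl rfl
  · rw [← transport_snd p p₀ τ, act_has]; exact Or.inr rfl

end Pair

/-- A permutation σ carries the complement of a pair to the complement of its image, but need not
preserve the increasing enumeration; τ records the discrepancy. It is harmless for vectors symmetric
in the remaining components. -/
theorem exists_mergeMap_permute (σ : Equiv.Perm (Fin (N + 2))) (q : Pair N) :
    ∃ τ : Equiv.Perm (Fin N), ∀ x,
      mergeMap q (permute σ x) = permute (restPerm τ) (mergeMap (Pair.act σ q) x) := by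
  have h (k : Fin N) : ∃ j, σ (q.rest k) = (Pair.act σ q).rest j :=
    exists_rest fun hk => q.not_has_rest k (Pair.act_has.1 hk)
  choose t ht using h
  have hinj : Function.Injective t := fun a b hab => by
    apply q.rest_injective
    apply σ.injective
    rw [ht, ht, hab]
  refine ⟨Equiv.ofBijective t (Finite.injective_iff_bijective.1 hinj), fun x => ?_⟩
  ext1 l
  refine Fin.cases ?_ (fun k => ?_) l
  · rw [permute_apply, restPerm_zero, mergeMap_zero, mergeMap_zero, permute_apply, permute_apply,
      Pair.act_add σ q x]
  · rw [permute_apply, restPerm_succ, mergeMap_succ, mergeMap_succ, permute_apply, ht]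
    rfl

/-! ### Symmetry in the components other than the merged one -/

/-- The Fourier transforms of `v` and `w` agree after a permutation of the components other than
the first one. -/
def PermRel (τ : Equiv.Perm (Fin N)) (v w : L2 (N + 1)) : Prop :=
  ∀ᵐ q', hat v (permute (restPerm τ) q') = hat w q'

/-- Symmetry in all components but the first one. -/
def RestSymm (v : L2 (N + 1)) : Prop := ∀ τ : Equiv.Perm (Fin N), PermRel τ v v

theorem ae_permute {P : Config n → Prop} (σ : Equiv.Perm (Fin n)) (h : ∀ᵐ x, P x) :
    ∀ᵐ x, P (permute σ x) := (permute_mp σ).quasiMeasurePreserving.ae h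

theorem PermRel.sum {τ : Equiv.Perm (Fin N)} {ι : Type*} (s : Finset ι) {v w : ι → L2 (N + 1)}
    (h : ∀ i ∈ s, PermRel τ (v i) (w i)) : PermRel τ (∑ i ∈ s, v i) (∑ i ∈ s, w i) := by
  classical
  induction s using Finset.induction_on with
  | empty =>
    have h0 : ∀ᵐ q', hat (0 : L2 (N + 1)) q' = 0 := by
      rw [map_zero]; exact AEEqFun.coeFn_zero
    simp only [Finset.sum_empty]
    filter_upwards [h0, ae_permute (restPerm τ) h0] with q' h1 h2
    rw [h1, h2]
  | insert a s ha ih =>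
    rw [Finset.sum_insert ha, Finset.sum_insert ha]
    have h1 := h a (by simp)
    have h2 := ih fun i hi => h i (by simp [hi])
    have hadd (x y : L2 (N + 1)) : ∀ᵐ q', hat (x + y) q' = hat x q' + hat y q' := by
      rw [map_add]; exact AEEqFun.coeFn_add _ _
    filter_upwards [h1, h2, hadd (w a) (∑ i ∈ s, w i),
      ae_permute (restPerm τ) (hadd (v a) (∑ i ∈ s, v i))] with q' e1 e2 e3 e4
    rw [e3, e4, e1, e2]

theorem restPerm_one : restPerm (1 : Equiv.Perm (Fin N)) = 1 := by
  ext l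
  refine Fin.cases ?_ (fun k => ?_) l <;> simp

theorem PermRel.eq {v w : L2 (N + 1)} (h : PermRel 1 v w) : v = w := by
  refine hat_injective (AEEqFun.ext ?_)
  filter_upwards [h] with q' hq
  rw [← hq, restPerm_one]
  rfl

/-- `permute_splitMap` turns the fibre integral for `p` at a permuted point into the one for `p₀`.
Keeping both the pair and τ free serves two ends: τ = 1 shows that different pairs give the same
vector, and p = p₀ shows that this vector is symmetric. -/
theorem permRel_of_fiberInt {p p₀ : Pair N} {τ : Equiv.Perm (Fin N)} {f f₀ : L2 (N + 2)}
    (hf : ∀ᵐ x, hat f (permute (p.transport p₀ τ) x) = hat f₀ x) {v v₀ : L2 (N + 1)}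
    (hv : ∀ᵐ q', hat v q' = fiberInt p f q') (hv₀ : ∀ᵐ q', hat v₀ q' = fiberInt p₀ f₀ q') :
    PermRel τ v v₀ := by
  unfold PermRel
  filter_upwards [splitMap_ae p₀ hf, hv₀, ae_permute (restPerm τ) hv] with q' h1 h2 h3
  rw [h2, h3]
  refine integral_congr_ae ?_
  filter_upwards [h1] with q₁ h
  rw [← h, permute_splitMap]

theorem permRel_incoming {z : ℂ} {G : L2 (N + 2) →L[ℂ] L2 (N + 2)}
    (hG : ∀ u, ∀ᵐ x, hat (G u) x = greenVal z x * hat u x)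
    {S : Pair N → L2 (N + 2) →L[ℂ] L2 (N + 1)}
    (hS : ∀ p u, ∀ᵐ q', hat (S p u) q' = fiberInt p (G u) q')
    {u : L2 (N + 2)} (hu : IsSymm u) (p p₀ : Pair N) (τ : Equiv.Perm (Fin N)) :
    PermRel τ (S p u) (S p₀ u) := by
  refine permRel_of_fiberInt (p := p) (p₀ := p₀) ?_ (hS p u) (hS p₀ u)
  filter_upwards [hG u, ae_permute (p.transport p₀ τ) (hG u),
    hat_permute_of_isSymm hu (p.transport p₀ τ)] with x h1 h2 h3
  rw [h1, h2, h3, greenVal_permute]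

/-- A single M_{pq} breaks the symmetry; only the full sum over q ≠ p is invariant, because the
permutation reshuffles its terms. -/
theorem permRel_mediating {z : ℂ} {O : Pair N → L2 (N + 1) →L[ℂ] L2 (N + 2)}
    (hO : ∀ q v, ∀ᵐ x, hat (O q v) x = greenVal z x * hat v (mergeMap q x))
    {M : Pair N → Pair N → L2 (N + 1) →L[ℂ] L2 (N + 1)}
    (hM : ∀ p q, p ≠ q → ∀ v, ∀ᵐ q', hat (M p q v) q' = fiberInt p (O q v) q')
    {v : L2 (N + 1)} (hv : RestSymm v) (p p₀ : Pair N) (τ : Equiv.Perm (Fin N)) :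
    PermRel τ (∑ q with p ≠ q, M p q v) (∑ q with p₀ ≠ q, M p₀ q v) := by
  set σ := p.transport p₀ τ with hσ
  have hp : Pair.act σ p = p₀ := Pair.act_transport p p₀ τ
  -- The sum is reindexed by the action of σ on pairs, a bijection taking p to p₀ and hence the
  -- pairs q ≠ p to those different from p₀.
  have h1 : ∑ q with p₀ ≠ q, M p₀ q v = ∑ q with p ≠ q, M p₀ (Pair.act σ q) v := by
    refine (Finset.sum_equiv (Pair.actEquiv σ) (fun q => ?_) fun q _ => rfl).symm
    simp only [Finset.mem_filter, Finset.mem_univ, true_and, ne_eq]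
    rw [← hp]
    exact not_congr (Pair.act_injective σ).eq_iff.symm
  rw [h1]
  refine PermRel.sum _ fun q hq => ?_
  have hpq : p ≠ q := (Finset.mem_filter.1 hq).2
  have hpq' : p₀ ≠ Pair.act σ q := by
    rw [← hp]; exact fun h => hpq (Pair.act_injective σ h)
  refine permRel_of_fiberInt (p := p) (p₀ := p₀) ?_ (hM p q hpq v) (hM p₀ _ hpq' v)
  obtain ⟨t, ht⟩ := exists_mergeMap_permute σ q
  filter_upwards [hO (Pair.act σ q) v, ae_permute σ (hO q v),
    (mergeMap_qmp (Pair.act σ q)).ae (hv t)] with x h2 h3 h4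
  rw [h2, ← hσ, h3, greenVal_permute, ht, h4]

theorem RestSymm.jInv {β : ℝ} {z : ℂ} {J : L2 (N + 1) →L[ℂ] L2 (N + 1)}
    (hJ : ∀ v, hat (J v) = mulFreq (jInvSymbol N β z) (hat v)) {v : L2 (N + 1)}
    (hv : RestSymm v) : RestSymm (J v) := by
  intro τ
  have h : ∀ᵐ ξ, hat (J v) ξ = (jVal β z ξ)⁻¹ * hat v ξ := by
    rw [hJ]
    filter_upwards [mulFreq_ae (jInvSymbol N β z) (hat v), jInvSymbol_ae (N := N) β z] with ξ h1 h2
    rw [h1, h2]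
  unfold PermRel
  filter_upwards [h, ae_permute (restPerm τ) h, hv τ] with ξ h1 h2 h3
  rw [h1, h2, h3, jVal, jVal, jEnergy_permute]

theorem RestSymm.smul {v : L2 (N + 1)} (hv : RestSymm v) (c : ℂ) : RestSymm (c • v) := by
  intro τ
  have h : ∀ᵐ ξ, hat (c • v) ξ = c * hat v ξ := by
    rw [map_smul]; exact AEEqFun.coeFn_smul c (hat v)
  unfold PermRel
  filter_upwards [h, ae_permute (restPerm τ) h, hv τ] with ξ h1 h2 h3
  rw [h1, h2, h3]

/-! ### The resolvent series -/

section Series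

variable {P E F : Type*} [NormedAddCommGroup E] [NormedSpace ℂ E] [NormedAddCommGroup F]
  [NormedSpace ℂ F]

/-- Consecutive entries are different. -/
abbrev Alternating {k : ℕ} (d : Fin (k + 1) → P) : Prop := ∀ s : Fin k, d s.castSucc ≠ d s.succ

/-- The product `J ∏ (M J)` along a sequence of indices, for bounded operators. -/
def boundedChain (J : E →L[ℂ] E) (M : P → P → E →L[ℂ] E) :
    (k : ℕ) → (Fin (k + 1) → P) → E →L[ℂ] E
  | 0, _ => J
  | k + 1, d => J ∘L (M (d 0) (d 1) ∘L boundedChain J M k (Fin.tail d))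

/-- The summand that belongs to a sequence of indices, for bounded operators. -/
def boundedTerm (J : E →L[ℂ] E) (M : P → P → E →L[ℂ] E) (O : P → E →L[ℂ] F) (I : P → F →L[ℂ] E)
    (k : ℕ) (d : Fin (k + 1) → P) : F →L[ℂ] F :=
  O (d 0) ∘L (boundedChain J M k d ∘L I (d (Fin.last k)))

theorem Alternating.tail {k : ℕ} {d : Fin (k + 2) → P} (h : Alternating d) :
    Alternating (Fin.tail d) := fun s => h s.succ

theorem Alternating.ne {k : ℕ} {d : Fin (k + 2) → P} (h : Alternating d) : d 0 ≠ d 1 := h 0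

theorem alternating_cons_cons {k : ℕ} {p q : P} {d : Fin k → P} :
    Alternating (Fin.cons p (Fin.cons q d : Fin (k + 1) → P) : Fin (k + 2) → P) ↔
      p ≠ q ∧ Alternating (Fin.cons q d : Fin (k + 1) → P) :=
  ⟨fun h => ⟨h.ne, h.tail⟩, fun h s => Fin.cases h.1 (fun t => h.2 t) s⟩

variable {J : E →L[ℂ] E} {M : P → P → E →L[ℂ] E} {O : P → E →L[ℂ] F} {I : P → F →L[ℂ] E} {b : ℝ}

theorem norm_boundedChain_le (hM : ∀ p q, p ≠ q → ‖M p q‖ ≤ b) :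
    ∀ (k : ℕ) (d : Fin (k + 1) → P), Alternating d →
      ‖boundedChain J M k d‖ ≤ ‖J‖ * (b * ‖J‖) ^ k
  | 0, d, _ => by simp [boundedChain]
  | k + 1, d, h => by
    have h1 := norm_boundedChain_le hM k (Fin.tail d) h.tail
    have h2 := hM _ _ h.ne
    have hb : 0 ≤ b := (norm_nonneg _).trans h2
    calc ‖boundedChain J M (k + 1) d‖
        ≤ ‖J‖ * ‖M (d 0) (d 1) ∘L boundedChain J M k (Fin.tail d)‖ :=
          ContinuousLinearMap.opNorm_comp_le _ _
      _ ≤ ‖J‖ * (b * (‖J‖ * (b * ‖J‖) ^ k)) := by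
          gcongr
          exact (ContinuousLinearMap.opNorm_comp_le _ _).trans (by gcongr)
      _ = _ := by ring

/-- Each further pair costs a factor b‖J‖ in norm and at most |P| in the number of sequences, so the
sum over lengths is geometric. -/
theorem summable_norm_boundedTerm [Fintype P] [DecidableEq P]
    (hM : ∀ p q, p ≠ q → ‖M p q‖ ≤ b) (hb : 0 ≤ b)
    (h : Fintype.card P * (b * ‖J‖) < 1) :
    Summable fun d : Σ k : ℕ, {d : Fin (k + 1) → P // Alternating d} =>
      ‖boundedTerm J M O I d.1 d.2.1‖ := by
  set a := ∑ p, ‖O p‖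
  set e := ∑ p, ‖I p‖
  have ha (p : P) : ‖O p‖ ≤ a :=
    Finset.single_le_sum (f := fun p => ‖O p‖) (fun _ _ => norm_nonneg _) (Finset.mem_univ p)
  have he (p : P) : ‖I p‖ ≤ e :=
    Finset.single_le_sum (f := fun p => ‖I p‖) (fun _ _ => norm_nonneg _) (Finset.mem_univ p)
  have ha0 : 0 ≤ a := Finset.sum_nonneg fun _ _ => norm_nonneg _
  have he0 : 0 ≤ e := Finset.sum_nonneg fun _ _ => norm_nonneg _
  have hbd (k : ℕ) (d : {d : Fin (k + 1) → P // Alternating d}) :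
      ‖boundedTerm J M O I k d.1‖ ≤ a * (‖J‖ * (b * ‖J‖) ^ k * e) := by
    refine (ContinuousLinearMap.opNorm_comp_le _ _).trans ?_
    refine mul_le_mul (ha _) ?_ (norm_nonneg _) ha0
    refine (ContinuousLinearMap.opNorm_comp_le _ _).trans ?_
    exact mul_le_mul (norm_boundedChain_le hM k d.1 d.2) (he _) (norm_nonneg _) (by positivity)
  rw [summable_sigma_of_nonneg fun _ => norm_nonneg _]
  refine ⟨fun k => (hasSum_fintype _).summable, ?_⟩
  have hgeo := (summable_geometric_of_lt_one (by positivity) h).mul_left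
    (Fintype.card P * (a * (‖J‖ * e)))
  refine Summable.of_nonneg_of_le (fun k => tsum_nonneg fun _ => norm_nonneg _) (fun k => ?_) hgeo
  rw [tsum_fintype]
  -- The alternation condition is dropped in the count. The exponent k + 1 puts one extra factor |P|
  -- into the constant and leaves the ratio unaffected.
  have hcard : (Fintype.card {d : Fin (k + 1) → P // Alternating d} : ℝ) ≤
      (Fintype.card P : ℝ) ^ (k + 1) := by
    have := Fintype.card_subtype_le (fun d : Fin (k + 1) → P => Alternating d)
    rw [Fintype.card_fun, Fintype.card_fin] at this
    exact_mod_cast this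
  calc ∑ d : {d : Fin (k + 1) → P // Alternating d}, ‖boundedTerm J M O I k d.1‖
      ≤ ∑ d : {d : Fin (k + 1) → P // Alternating d}, a * (‖J‖ * (b * ‖J‖) ^ k * e) :=
        Finset.sum_le_sum fun d _ => hbd k d
    _ = (Fintype.card {d : Fin (k + 1) → P // Alternating d} : ℝ) *
          (a * (‖J‖ * (b * ‖J‖) ^ k * e)) := by
        rw [Finset.sum_const, nsmul_eq_mul, Finset.card_univ]
    _ ≤ (Fintype.card P : ℝ) ^ (k + 1) * (a * (‖J‖ * (b * ‖J‖) ^ k * e)) := by gcongr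
    _ = _ := by ring

/-- By induction on the length: with the first two entries p, q fixed, the sum over the tail is a
vector independent of q, so the sum of M p q over q ≠ p acts on it as `B`. That identity is assumed
only along the iterates, since it needs their symmetry. -/
theorem sum_boundedChain [Fintype P] [DecidableEq P] {B : E →L[ℂ] E} {φ : E}
    (hB : ∀ k p, ∑ q with p ≠ q, M p q (((J ∘L B) ^ k) (J φ)) = B (((J ∘L B) ^ k) (J φ)))
    (k : ℕ) (p : P) :
    ∑ d : Fin k → P, (if Alternating (Fin.cons p d : Fin (k + 1) → P) then
      boundedChain J M k (Fin.cons p d : Fin (k + 1) → P) φ else 0) = ((J ∘L B) ^ k) (J φ) := by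
  induction k generalizing p with
  | zero =>
    rw [Fintype.sum_unique, if_pos (fun s => s.elim0)]
    simp [boundedChain]
  | succ k ih =>
    rw [← (Fin.consEquiv fun _ : Fin (k + 1) => P).sum_comp, Fintype.sum_prod_type]
    have h1 (q : P) : ∑ d : Fin k → P,
        (if Alternating (Fin.cons p (Fin.cons q d : Fin (k + 1) → P) : Fin (k + 2) → P) then
          boundedChain J M (k + 1)
            (Fin.cons p (Fin.cons q d : Fin (k + 1) → P) : Fin (k + 2) → P) φ else 0) =
        if p ≠ q then J (M p q (((J ∘L B) ^ k) (J φ))) else 0 := by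
      split_ifs with hpq
      · rw [← ih q, map_sum, map_sum]
        refine Finset.sum_congr rfl fun d _ => ?_
        by_cases hd : Alternating (Fin.cons q d : Fin (k + 1) → P)
        · rw [if_pos (alternating_cons_cons.2 ⟨hpq, hd⟩), if_pos hd]
          rfl
        · rw [if_neg (fun h => hd (alternating_cons_cons.1 h).2), if_neg hd, map_zero, map_zero]
      · exact Finset.sum_eq_zero fun d _ => if_neg fun h => hpq (alternating_cons_cons.1 h).1
    refine (Finset.sum_congr rfl fun q _ => h1 q).trans ?_
    rw [← Finset.sum_filter, ← map_sum, hB, pow_succ']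
    rfl

theorem sum_boundedTerm [Fintype P] [DecidableEq P] {B : E →L[ℂ] E} {φ : E} {u : F}
    (hu : ∀ p, I p u = φ)
    (hB : ∀ k p, ∑ q with p ≠ q, M p q (((J ∘L B) ^ k) (J φ)) = B (((J ∘L B) ^ k) (J φ)))
    (k : ℕ) :
    ∑ d : {d : Fin (k + 1) → P // Alternating d}, boundedTerm J M O I k d.1 u =
      (∑ p, O p) (((J ∘L B) ^ k) (J φ)) := by
  rw [← Finset.sum_subtype (Finset.univ.filter fun d : Fin (k + 1) → P => Alternating d)
    (fun d => by simp) (fun d => boundedTerm J M O I k d u), Finset.sum_filter,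
    ← (Fin.consEquiv fun _ : Fin (k + 1) => P).sum_comp, Fintype.sum_prod_type,
    sum_apply]
  refine Finset.sum_congr rfl fun p _ => ?_
  rw [← sum_boundedChain hB k p, map_sum]
  refine Finset.sum_congr rfl fun d _ => ?_
  change (if Alternating (Fin.cons p d : Fin (k + 1) → P) then _ else _) = _
  split_ifs
  · change O p (boundedChain J M k (Fin.cons p d : Fin (k + 1) → P) (I _ u)) = _
    rw [hu]
  · rw [map_zero]

/-- Absolute convergence allows grouping the diagrams by length; each group is one term of the
Neumann series of 1 - JB, and limits are unique. -/
theorem tsum_boundedTerm_apply [Fintype P] [DecidableEq P] [CompleteSpace E] [CompleteSpace F]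
    {B : E →L[ℂ] E} {φ : E} {u : F} (hu : ∀ p, I p u = φ)
    (hB : ∀ k p, ∑ q with p ≠ q, M p q (((J ∘L B) ^ k) (J φ)) = B (((J ∘L B) ^ k) (J φ)))
    (hs : Summable fun d : Σ k : ℕ, {d : Fin (k + 1) → P // Alternating d} =>
      ‖boundedTerm J M O I d.1 d.2.1‖)
    (hJB : ‖J ∘L B‖ < 1) :
    (∑' d : Σ k : ℕ, {d : Fin (k + 1) → P // Alternating d}, boundedTerm J M O I d.1 d.2.1) u =
      (∑ p, O p) ((∑' k : ℕ, (J ∘L B) ^ k) (J φ)) := by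
  set T := ∑' d : Σ k : ℕ, {d : Fin (k + 1) → P // Alternating d}, boundedTerm J M O I d.1 d.2.1
  have hT : HasSum (fun d : Σ k : ℕ, {d : Fin (k + 1) → P // Alternating d} =>
      boundedTerm J M O I d.1 d.2.1) T := hs.of_norm.hasSum
  have h1 : HasSum (fun d : Σ k : ℕ, {d : Fin (k + 1) → P // Alternating d} =>
      boundedTerm J M O I d.1 d.2.1 u) (T u) := hT.mapL (ContinuousLinearMap.apply ℂ F u)
  have h2 : HasSum (fun k => (∑ p, O p) (((J ∘L B) ^ k) (J φ))) (T u) := by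
    refine h1.sigma fun k => ?_
    rw [← sum_boundedTerm (O := O) hu hB k]
    exact hasSum_fintype _
  have h3 : HasSum (fun k => ((J ∘L B) ^ k) (J φ)) ((∑' k : ℕ, (J ∘L B) ^ k) (J φ)) :=
    (summable_geometric_of_norm_lt_one hJB).hasSum.mapL (ContinuousLinearMap.apply ℂ E (J φ))
  exact h2.unique (h3.mapL (∑ p, O p))

theorem add_tsum_boundedTerm_apply [Fintype P] [DecidableEq P] [CompleteSpace E] [CompleteSpace F]
    {B : E →L[ℂ] E} {φ : E} {u : F} {a : ℂ} (G : F →L[ℂ] F) (ha : a * (Fintype.card P : ℂ) = 1)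
    (hu : ∀ p, I p u = φ)
    (hB : ∀ k p, ∑ q with p ≠ q, M p q (((J ∘L B) ^ k) (J φ)) = B (((J ∘L B) ^ k) (J φ)))
    (hs : Summable fun d : Σ k : ℕ, {d : Fin (k + 1) → P // Alternating d} =>
      ‖boundedTerm J M O I d.1 d.2.1‖)
    (hJB : ‖J ∘L B‖ < 1) :
    (G + ∑' d : Σ k : ℕ, {d : Fin (k + 1) → P // Alternating d}, boundedTerm J M O I d.1 d.2.1) u =
      (G + a • ((∑ p, O p) ∘L (((∑' k : ℕ, (J ∘L B) ^ k) ∘L J) ∘L ∑ p, I p))) u := by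
  have hI : (∑ p, I p) u = (Fintype.card P : ℂ) • φ := by
    rw [sum_apply, Finset.sum_congr rfl fun p _ => hu p, Finset.sum_const, Finset.card_univ,
      Nat.cast_smul_eq_nsmul]
  rw [add_apply, add_apply, tsum_boundedTerm_apply hu hB hs hJB, smul_apply,
    ContinuousLinearMap.comp_apply, ContinuousLinearMap.comp_apply, ContinuousLinearMap.comp_apply,
    hI, map_smul, map_smul, map_smul, smul_smul, ha, one_smul]

theorem geom_series_apply [CompleteSpace E] {B : E →L[ℂ] E} (h : ‖J ∘L B‖ < 1) (x : E) :
    (∑' k : ℕ, (J ∘L B) ^ k) (x - J (B x)) = x ∧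
      (∑' k : ℕ, (J ∘L B) ^ k) x - J (B ((∑' k : ℕ, (J ∘L B) ^ k) x)) = x :=
  ⟨congrArg (fun A : E →L[ℂ] E => A x) (geom_series_mul_neg _ h),
    congrArg (fun A : E →L[ℂ] E => A x) (mul_neg_geom_series _ h)⟩

end Series

/-! ### Counting pairs and transferring the bounds to the chains -/

theorem card_pair (N : ℕ) : Fintype.card (Pair N) * 2 = (N + 2) * (N + 1) := by
  have h1 : Fintype.card (Pair N) = ∑ j : Fin (N + 2), (j : ℕ) := by
    rw [Fintype.card_subtype, Finset.card_filter, ← Finset.univ_product_univ,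
      Finset.sum_product_right]
    refine Finset.sum_congr rfl fun j _ => ?_
    rw [← Finset.card_filter, ← Fin.card_Iio j]
    congr 1
    ext i
    simp
  rw [h1, Fin.sum_univ_eq_sum_range (fun i => i), Finset.sum_range_id_mul_two]
  rfl

theorem pairCoeff_mul_card (N : ℕ) : pairCoeff N * (Fintype.card (Pair N) : ℂ) = 1 := by
  have h : (Fintype.card (Pair N) : ℂ) * 2 = ((N : ℂ) + 2) * ((N : ℂ) + 1) := by
    exact_mod_cast card_pair N
  have h1 : (N : ℂ) + 2 ≠ 0 := by exact_mod_cast (N + 1).succ_ne_zero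
  have h2 : (N : ℂ) + 1 ≠ 0 := by exact_mod_cast N.succ_ne_zero
  rw [pairCoeff, div_mul_eq_mul_div, mul_comm, h, div_self (mul_ne_zero h1 h2)]

theorem card_pair_le (N : ℕ) : (Fintype.card (Pair N) : ℝ) ≤ ((N + 2 : ℕ) : ℝ) ^ 2 / 2 := by
  have h : (Fintype.card (Pair N) : ℝ) * 2 = ((N : ℝ) + 2) * ((N : ℝ) + 1) := by
    exact_mod_cast card_pair N
  push_cast
  nlinarith [(Nat.cast_nonneg N : (0 : ℝ) ≤ N)]

/-- A rescaled two-sided inverse. -/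
theorem smul_inverse {E : Type*} [NormedAddCommGroup E] [NormedSpace ℂ E] {A : E →ₗ.[ℂ] E}
    {T : E →L[ℂ] E} (h1 : ∀ y, ∃ hy : T y ∈ A.domain, A ⟨T y, hy⟩ = y)
    (h2 : ∀ x : A.domain, T (A x) = x) {a b : ℂ} (hab : a * b = 1) :
    (∀ y, ∃ hy : (b • T) y ∈ (a • A).domain, (a • A) ⟨(b • T) y, hy⟩ = y) ∧
      ∀ x : (a • A).domain, (b • T) ((a • A) x) = x := by
  constructor
  · intro y
    obtain ⟨hy, hA⟩ := h1 y
    refine ⟨A.domain.smul_mem b hy, ?_⟩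
    rw [LinearPMap.smul_apply]
    have : A ⟨b • T y, A.domain.smul_mem b hy⟩ = b • y := by
      exact (A.map_smul b ⟨T y, hy⟩).trans (congrArg (b • ·) hA)
    refine (congrArg (a • ·) this).trans ?_
    simp [smul_smul, hab]
  · intro x
    rw [LinearPMap.smul_apply, smul_apply, map_smul, smul_smul, mul_comm, hab,
      one_smul]
    exact h2 x

theorem isBdd_chain {β : ℝ} {z : ℂ} {J : L2 (N + 1) →L[ℂ] L2 (N + 1)} (hJ : IsBdd (jInv N β z) J)
    {M : Pair N → Pair N → L2 (N + 1) →L[ℂ] L2 (N + 1)}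
    (hM : ∀ p q, p ≠ q → IsBdd (mediating z p q) (M p q)) :
    ∀ (k : ℕ) (d : Fin (k + 1) → Pair N), Alternating d →
      IsBdd (chain β z k d) (boundedChain J M k d)
  | 0, _, _ => hJ
  | k + 1, d, h => hJ.pcomp ((hM _ _ h.ne).pcomp (isBdd_chain hJ hM k (Fin.tail d) h.tail))

/-! ### The averaged operator and the comparison of the two resolvents -/

section Final

variable {β : ℝ} {z : ℂ} {M : Pair N → Pair N → L2 (N + 1) →L[ℂ] L2 (N + 1)}

/-- The mean over `p` of the operators `∑_{q ≠ p} M p q`. -/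
def meanOp (M : Pair N → Pair N → L2 (N + 1) →L[ℂ] L2 (N + 1)) : L2 (N + 1) →L[ℂ] L2 (N + 1) :=
  pairCoeff N • ∑ c : Pair N × Pair N with c.1 ≠ c.2, M c.1 c.2

/-- There are at most |Pair|² couples, and the coefficient is 1/|Pair|. The resulting bound makes
the smallness condition for the Neumann series the same as the one for the diagram series. -/
theorem norm_meanOp_le {b : ℝ} (hb : 0 ≤ b) (hM : ∀ p q, p ≠ q → ‖M p q‖ ≤ b) :
    ‖meanOp M‖ ≤ Fintype.card (Pair N) * b := by
  have h1 : ‖pairCoeff N‖ * Fintype.card (Pair N) = 1 := by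
    rw [← Complex.norm_natCast (Fintype.card (Pair N)), ← norm_mul, pairCoeff_mul_card, norm_one]
  have h2 : ‖∑ c : Pair N × Pair N with c.1 ≠ c.2, M c.1 c.2‖ ≤
      (Fintype.card (Pair N) : ℝ) ^ 2 * b := by
    refine (norm_sum_le_of_le _ fun c hc => hM c.1 c.2 (Finset.mem_filter.1 hc).2).trans ?_
    rw [Finset.sum_const, nsmul_eq_mul]
    refine mul_le_mul_of_nonneg_right ?_ hb
    have := Finset.card_filter_le (Finset.univ : Finset (Pair N × Pair N)) fun c => c.1 ≠ c.2
    rw [Finset.card_univ, Fintype.card_prod, ← sq] at this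
    exact_mod_cast this
  calc ‖meanOp M‖ ≤ ‖pairCoeff N‖ * ((Fintype.card (Pair N) : ℝ) ^ 2 * b) := by
        rw [meanOp, norm_smul]
        exact mul_le_mul_of_nonneg_left h2 (norm_nonneg _)
    _ = (‖pairCoeff N‖ * Fintype.card (Pair N)) * (Fintype.card (Pair N) * b) := by ring
    _ = _ := by rw [h1, one_mul]

theorem meanOp_apply {w : L2 (N + 1)}
    (hw : ∀ p p₀ : Pair N, ∑ q with p ≠ q, M p q w = ∑ q with p₀ ≠ q, M p₀ q w) (p : Pair N) :
    ∑ q with p ≠ q, M p q w = meanOp M w := by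
  have h : ∑ c : Pair N × Pair N with c.1 ≠ c.2, M c.1 c.2 w =
      ∑ p' : Pair N, ∑ q with p' ≠ q, M p' q w := by
    rw [Finset.sum_filter, Fintype.sum_prod_type]
    exact Finset.sum_congr rfl fun p' _ => (Finset.sum_filter _ _).symm
  rw [meanOp, smul_apply, sum_apply, h, Finset.sum_congr rfl fun p' _ => hw p' p, Finset.sum_const,
    Finset.card_univ, ← Nat.cast_smul_eq_nsmul ℂ, smul_smul, pairCoeff_mul_card, one_smul]

/-- A smallness condition under which all series converge. -/
theorem card_mul_lt_one {c : ℝ} (hc : c = 100 * ((N + 2 : ℕ) : ℝ) ^ 2) {t : ℝ}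
    (ht : t ≤ 4 * Real.pi * (1 / c)) : Fintype.card (Pair N) * (1 / 2 * t) < 1 := by
  have hn : 0 < ((N + 2 : ℕ) : ℝ) ^ 2 := by positivity
  have hpi := Real.pi_lt_four
  have hpi0 := Real.pi_pos
  have h1 : 1 / 2 * t ≤ 2 * Real.pi * (1 / c) := by linarith
  -- The product is at most (n²/2) · ½ · 4π/(100n²) = π/100, so any constant larger than π in place
  -- of 100 would make it less than 1.
  calc (Fintype.card (Pair N) : ℝ) * (1 / 2 * t)
      ≤ Fintype.card (Pair N) * (2 * Real.pi * (1 / c)) := by gcongr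
    _ ≤ ((N + 2 : ℕ) : ℝ) ^ 2 / 2 * (2 * Real.pi * (1 / c)) := by
        refine mul_le_mul_of_nonneg_right (card_pair_le N) ?_
        rw [hc]; positivity
    _ = Real.pi / 100 := by rw [hc]; field_simp
    _ < 1 := by linarith

/-- On symmetric functions the incoming operators agree, and on the iterates of the result the sums
`∑_{q ≠ p} M p q` agree with their mean. -/
theorem exists_common_incoming {G : L2 (N + 2) →L[ℂ] L2 (N + 2)}
    {I : Pair N → L2 (N + 2) →L[ℂ] L2 (N + 1)} {O : Pair N → L2 (N + 1) →L[ℂ] L2 (N + 2)}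
    {J : L2 (N + 1) →L[ℂ] L2 (N + 1)} (a : ℂ)
    (hG : ∀ u, ∀ᵐ x, hat (G u) x = greenVal z x * hat u x)
    (hI : ∀ p u, ∀ᵐ q', hat (I p u) q' = fiberInt p (G u) q')
    (hO : ∀ q v, ∀ᵐ x, hat (O q v) x = greenVal z x * hat v (mergeMap q x))
    (hM : ∀ p q, p ≠ q → ∀ v, ∀ᵐ q', hat (M p q v) q' = fiberInt p (O q v) q')
    (hJ : ∀ v, hat (J v) = mulFreq (jInvSymbol N β z) (hat v))
    {u : L2 (N + 2)} (hu : IsSymm u) :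
    ∃ φ, (∀ p, I p u = φ) ∧ ∀ k p,
      ∑ q with p ≠ q, M p q ((((a • J) ∘L meanOp M) ^ k) ((a • J) φ)) =
        meanOp M ((((a • J) ∘L meanOp M) ^ k) ((a • J) φ)) := by
  -- A reference pair, available because n = N + 2 ≥ 2.
  let p₀ : Pair N := ⟨(0, 1), Fin.zero_lt_one⟩
  have hrel := permRel_incoming hG hI hu
  have hφ (p : Pair N) : I p u = I p₀ u := (hrel p p₀ 1).eq
  have hmean (w : L2 (N + 1)) (hw : RestSymm w) (p : Pair N) :
      ∑ q with p ≠ q, M p q w = meanOp M w :=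
    meanOp_apply (fun p p₀ => (permRel_mediating hO hM hw p p₀ 1).eq) p
  have hJs (w : L2 (N + 1)) (hw : RestSymm w) : RestSymm ((a • J) w) := (hw.jInv hJ).smul a
  refine ⟨I p₀ u, hφ, fun k p => hmean _ ?_ p⟩
  induction k with
  | zero => exact hJs _ (hrel p₀ p₀)
  | succ k ih =>
    rw [pow_succ', mul_apply_eq_comp, ContinuousLinearMap.comp_apply]
    -- On a symmetric vector the mean may be replaced by the single sum at p₀, for which invariance
    -- under τ is already known.
    refine hJs _ fun τ => ?_
    rw [← hmean _ ih p₀]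
    exact permRel_mediating hO hM ih p₀ p₀ τ

set_option maxHeartbeats 1000000 in
-- Since `J` inverts (4π)⁻¹(𝒥_z - β), the operator is formally J⁻¹(1 - JB), with inverse (1 - JB)⁻¹J
-- given by the Neumann series.
theorem isBdd_symOp_inverse {J₀ : L2 (N + 1) →L[ℂ] L2 (N + 1)}
    (hJ1 : ∀ y, ∃ hy : J₀ y ∈ (jSub N β z).domain, jSub N β z ⟨J₀ y, hy⟩ = y)
    (hJ2 : ∀ x : (jSub N β z).domain, J₀ (jSub N β z x) = x)
    (hM : ∀ p q, p ≠ q → IsBdd (mediating z p q) (M p q))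
    {J : L2 (N + 1) →L[ℂ] L2 (N + 1)} (hJ : J = ((4 * Real.pi : ℝ) : ℂ) • J₀)
    (hJB : ‖J ∘L meanOp M‖ < 1) :
    LinearMap.ker (symOp N β z).toFun = ⊥ ∧
      IsBdd (symOp N β z).inverse ((∑' k : ℕ, (J ∘L meanOp M) ^ k) ∘L J) := by
  have hB : IsBdd (pairCoeff N • ∑ c : Pair N × Pair N with c.1 ≠ c.2, mediating z c.1 c.2)
      (meanOp M) :=
    (IsBdd.sum _ fun c hc => hM c.1 c.2 (Finset.mem_filter.1 hc).2).smul _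
  obtain ⟨h1, h2⟩ := smul_inverse hJ1 hJ2 (a := ((1 / (4 * Real.pi) : ℝ) : ℂ))
    (b := ((4 * Real.pi : ℝ) : ℂ)) (by
      rw [← Complex.ofReal_mul, one_div_mul_cancel (by positivity), Complex.ofReal_one])
  rw [← hJ] at h1 h2
  exact isBdd_inverse_sub h1 h2 hB
    (fun x => (geom_series_apply hJB x).1) (fun x => (geom_series_apply hJB x).2)

theorem isBdd_term {J : L2 (N + 1) →L[ℂ] L2 (N + 1)} (hJ : IsBdd (jInv N β z) J)
    (hM : ∀ p q, p ≠ q → IsBdd (mediating z p q) (M p q))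
    {O : Pair N → L2 (N + 1) →L[ℂ] L2 (N + 2)} (hO : ∀ p, IsBdd (outgoing z p) (O p))
    {I : Pair N → L2 (N + 2) →L[ℂ] L2 (N + 1)} (hI : ∀ p, IsBdd (incoming z p) (I p)) (d : Dgm N) :
    IsBdd (term β z d) (boundedTerm J M O I d.1 d.2.1) :=
  (hO _).pcomp ((isBdd_chain hJ hM d.1 d.2.1 d.2.2).pcomp (hI _))

theorem isBdd_symResolvent {G : L2 (N + 2) →L[ℂ] L2 (N + 2)} (hG : IsBdd (green (N + 2) z) G)
    {K : L2 (N + 1) →L[ℂ] L2 (N + 1)} (hK : IsBdd (symOp N β z).inverse K)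
    {O : Pair N → L2 (N + 1) →L[ℂ] L2 (N + 2)} (hO : ∀ p, IsBdd (outgoing z p) (O p))
    {I : Pair N → L2 (N + 2) →L[ℂ] L2 (N + 1)} (hI : ∀ p, IsBdd (incoming z p) (I p)) :
    IsBdd (symResolvent N β z) (G + pairCoeff N • ((∑ p, O p) ∘L (K ∘L ∑ p, I p))) :=
  hG.add (((IsBdd.sum _ fun p _ => hO p).pcomp (hK.pcomp (IsBdd.sum _ fun p _ => hI p))).smul _)

set_option maxHeartbeats 1000000 in
theorem resolvent_formula (hz : z.re < -Real.exp (100 * ((N + 2 : ℕ) : ℝ) ^ 2 + β)) :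
    HasBddInverse (jSub N β z) ∧ HasBddInverse (symOp N β z) ∧
      ∃ (G R Rsym : L2 (N + 2) →L[ℂ] L2 (N + 2)) (T : Dgm N → L2 (N + 2) →L[ℂ] L2 (N + 2)),
        IsBdd (green (N + 2) z) G ∧ (∀ d : Dgm N, IsBdd (term β z d) (T d)) ∧
        (Summable fun d : Dgm N => ‖T d‖) ∧ HasSum T (R - G) ∧
        IsBdd (symResolvent N β z) Rsym ∧ ∀ u : L2 (N + 2), IsSymm u → R u = Rsym u := by
  obtain ⟨c, hc⟩ : ∃ c : ℝ, c = 100 * ((N + 2 : ℕ) : ℝ) ^ 2 := ⟨_, rfl⟩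
  rw [← hc] at hz
  have hc0 : 0 < c := by rw [hc]; positivity
  have hz0 : z.re < 0 := hz.trans (neg_lt_zero.2 (Real.exp_pos _))
  obtain ⟨G, hG, hGh⟩ := exists_isBdd_green (n := N + 2) hz0
  choose O hO hOh using fun p : Pair N => exists_isBdd_outgoing hz0 p
  choose I hI hIh using fun p : Pair N => exists_isBdd_incoming hz0 p hG hGh
  have hMex (p q : Pair N) : ∃ S : L2 (N + 1) →L[ℂ] L2 (N + 1), p ≠ q →
      IsBdd (mediating z p q) S ∧ ‖S‖ ≤ 1 / 2 ∧
        ∀ v, ∀ᵐ q', hat (S v) q' = fiberInt p (O q v) q' := by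
    by_cases hpq : p = q
    · exact ⟨0, fun h => absurd hpq h⟩
    · obtain ⟨S, hS⟩ := exists_isBdd_mediating hz0 hpq (hO q) (hOh q)
      exact ⟨S, fun _ => hS⟩
  choose M hMall using hMex
  have hM (p q : Pair N) (h : p ≠ q) := (hMall p q h).1
  have hMn (p q : Pair N) (h : p ≠ q) := (hMall p q h).2.1
  have hMh (p q : Pair N) (h : p ≠ q) := (hMall p q h).2.2
  obtain ⟨J₀, hJn, hJh, hJ1, hJ2⟩ := exists_jSub_inverse (N := N) hc0 hz
  obtain ⟨hker, hinv⟩ := isBdd_inverse hJ1 hJ2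
  obtain ⟨J, hJdef⟩ : ∃ J : L2 (N + 1) →L[ℂ] L2 (N + 1), J = ((4 * Real.pi : ℝ) : ℂ) • J₀ :=
    ⟨_, rfl⟩
  have hJ : IsBdd (jInv N β z) J := hJdef ▸ hinv.smul _
  have hJnorm : ‖J‖ ≤ 4 * Real.pi * (1 / c) := by
    rw [hJdef, norm_smul, Complex.norm_real, Real.norm_of_nonneg (by positivity)]
    exact mul_le_mul_of_nonneg_left hJn (by positivity)
  have hsmall := card_mul_lt_one hc hJnorm
  have hJB : ‖J ∘L meanOp M‖ < 1 := by
    refine lt_of_le_of_lt ((ContinuousLinearMap.opNorm_comp_le _ _).trans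
      (mul_le_mul_of_nonneg_left (norm_meanOp_le (by norm_num) hMn) (norm_nonneg _))) ?_
    linarith
  obtain ⟨hsker, hsinv⟩ := isBdd_symOp_inverse hJ1 hJ2 hM hJdef hJB
  have hsum : Summable fun d : Dgm N => ‖boundedTerm J M O I d.1 d.2.1‖ :=
    summable_norm_boundedTerm hMn (by norm_num) hsmall
  have hhas : HasSum (fun d : Dgm N => boundedTerm J M O I d.1 d.2.1)
      (∑' d : Dgm N, boundedTerm J M O I d.1 d.2.1) := hsum.of_norm.hasSum
  refine ⟨⟨hker, J₀, hinv⟩, ⟨hsker, _, hsinv⟩, G,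
    G + ∑' d : Dgm N, boundedTerm J M O I d.1 d.2.1, _,
    fun d => boundedTerm J M O I d.1 d.2.1, hG, isBdd_term hJ hM hO hI, hsum, ?_,
    isBdd_symResolvent hG hsinv hO hI, fun u hu => ?_⟩
  · rw [add_sub_cancel_left]
    exact hhas
  · obtain ⟨φ, hφ, hmean⟩ := exists_common_incoming ((4 * Real.pi : ℝ) : ℂ) hGh hIh hOh hMh hJh hu
    rw [← hJdef] at hmean
    exact add_tsum_boundedTerm_apply G (pairCoeff_mul_card N) hφ hmean hsum hJB

end Final

end DeltaBose
end

theorem proposition1p3 :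
    ∃ C : ℝ, 0 < C ∧ ∀ (N : ℕ) (β : ℝ) (z : ℂ),
      z.re < -Real.exp (C * ((N + 2 : ℕ) : ℝ) ^ 2 + β) →
      -- all inverses that occur below exist as bounded operators
      HasBddInverse (jSub N β z) ∧ HasBddInverse (symOp N β z) ∧
      ∃ (G R Rsym : L2 (N + 2) →L[ℂ] L2 (N + 2)) (T : Dgm N → L2 (N + 2) →L[ℂ] L2 (N + 2)),
        -- the series defines a bounded operator `R`, and converges absolutely in operator norm
        IsBdd (green (N + 2) z) G ∧ (∀ d : Dgm N, IsBdd (term β z d) (T d)) ∧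
        (Summable fun d : Dgm N => ‖T d‖) ∧ HasSum T (R - G) ∧
        -- on symmetric functions, `R` is given by the closed form
        IsBdd (symResolvent N β z) Rsym ∧ ∀ u : L2 (N + 2), IsSymm u → R u = Rsym u := by
  exact ⟨100, by norm_num, fun N β z hz => resolvent_formula hz⟩
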